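/- Let $(M,g,K)$ be a smooth 4-dimensional para-Kähler–Einstein (pKE) structure: $g$ is a metric of signature $(+,+,-,-)$, $K$ is an endomorphism field of $TM$ with $K^2=\mathrm{id}$, with $\pm1$-eigendistributions of rank 2, and with $g(KX,KY)=-g(X,Y)$; both eigendistributions are integrable, the 2-form $\rho(X,Y)=g(KX,Y)$ is closed, and the trace-free Ricci tensor of $g$ vanishes. A frame with dual coframe $(\theta^1,\theta^2,\theta^3,\theta^4)=(\alpha^1,\alpha^2,\bar\alpha^1,\bar\alpha^2)$ is adapted if $g=2\alpha^1\bar\alpha^1+2\alpha^2\bar\alpha^2$ (symmetric products $\alpha\beta=\frac12(\alpha\otimes\beta+\beta\otimes\alpha)$) and $K$ is $+1$ on $\partial/\partial\alpha^A$ and $-1$ on $\partial/\partial\bar\alpha^A$, $A=1,2$. Let $\pi:\mathcal F^8\to M$ be the principal $GL_2(\mathbb R)$-bundle of adapted frames, with its tautological 1-forms $\alpha=(\alpha^1,\alpha^2)^T$, $\bar\alpha=(\bar\alpha^1,\bar\alpha^2)$ and the Levi-Civita connection forms $\Gamma=(\Gamma^A{}_B)_{A,B=1,2}$ on $\mathcal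 F^8$, and let $$\mathcal A=\begin{pmatrix}\Gamma-\tfrac13\mathrm{tr}(\Gamma)\,\mathrm{id}&\alpha\\ \bar\alpha&-\tfrac13\mathrm{tr}(\Gamma)\end{pmatrix}$$ be the associated $\mathfrak{sl}_3(\mathbb R)$-valued Cartan connection, with curvature $K_{\mathcal A}=d\mathcal A+\mathcal A\wedge\mathcal A$. For a matrix-valued 2-form $\Omega$ put $D\Omega=d\Omega+\mathcal A\wedge\Omega-\Omega\wedge\mathcal A$. Let $*$ be the Hodge star of $g$ for the orientation $\alpha^1\wedge\alpha^2\wedge\bar\alpha^1\wedge\bar\alpha^2$, defined by $*\omega(X,Y)\,\mathrm{vol}=\omega\wedge X^\flat\wedge Y^\flat$ and extended to horizontal 2-forms on $\mathcal F^8$. Let $\Psi_2'=C_{1234}$ be the component of the Weyl tensor in adapted frames, where $$C_{abcd}=R_{abcd}+g_{ad}P_{cb}-g_{ac}P_{db}+g_{bc}P_{da}-g_{bd}P_{ca},\qquad P_{ab}=\tfrac12R_{ab}-\tfrac1{12}Rg_{ab},$$ $R_{ab}=R^c{}_{acb}$, $R=g^{ab}R_{ab}$, and $d\Gamma^a{}_b+\Gamma^a{}_c\wedge\Gamma^c{}_b=\frac12R^a{}_{bcd}\,\theta^c\wedge\theta^d$.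 It does not depend on the adapted frame. Then: 1. the Yang–Mills equations $D{*K_{\mathcal A}}=0$ hold on $\mathcal F^8$ if and only if $\Psi_2'=1$ everywhere on $M$; 2. the curvature is anti-self-dual, $*K_{\mathcal A}=-K_{\mathcal A}$, if and only if $\Psi_2'=1$ everywhere on $M$; 3. the Bianchi identity $DK_{\mathcal A}=0$ holds. -/

import Mathlib

open scoped Manifold ContDiff

set_option maxSynthPendingDepth 3

namespace ParaKahler

noncomputable section

variable {E : Type*} [NormedAddCommGroup E] [NormedSpace ℝ E]

/-! ### Exterior algebra

A `k`-form on a normed space `E` is a map `E → E [⋀^Fin k]→L[ℝ] ℝ`, and `d` is Mathlib's `extDeriv`.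
A `1`-covector is kept as an element of `E →L[ℝ] ℝ`. -/

section Exterior

/-- A `1`-covector as an alternating map in one variable. -/
def oneForm (α : E →L[ℝ] ℝ) : E [⋀^Fin 1]→L[ℝ] ℝ :=
  ContinuousAlternatingMap.ofSubsingleton ℝ E ℝ (0 : Fin 1) α

/-- The wedge product `α ∧ η` of a `1`-covector and an `n`-covector,
`(α ∧ η)(v₀, …, vₙ) = ∑ i, (-1)^i α(vᵢ) η(v₀, …, v̂ᵢ, …, vₙ)`. -/
def wedge {n : ℕ} (α : E →L[ℝ] ℝ) (η : E [⋀^Fin n]→L[ℝ] ℝ) : E [⋀^Fin (n + 1)]→L[ℝ] ℝ :=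
  ContinuousAlternatingMap.alternatizeUncurryFin (α.smulRight η)

/-- The wedge product `α ∧ β` of two `1`-covectors. -/
def wedge₁ (α β : E →L[ℝ] ℝ) : E [⋀^Fin 2]→L[ℝ] ℝ := wedge α (oneForm β)

theorem wedge₁_apply (α β : E →L[ℝ] ℝ) (v : Fin 2 → E) :
    wedge₁ α β v = α (v 0) * β (v 1) - α (v 1) * β (v 0) := by
  simp [wedge₁, wedge, oneForm, ContinuousAlternatingMap.alternatizeUncurryFin_apply,
    Fin.sum_univ_two, Fin.removeNth_apply]
  ring

theorem wedge_two (α : E →L[ℝ] ℝ) (η : E [⋀^Fin 2]→L[ℝ] ℝ) (v : Fin 3 → E) :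
    wedge α η v = α (v 0) * η ![v 1, v 2] - α (v 1) * η ![v 0, v 2] + α (v 2) * η ![v 0, v 1] := by
  rw [wedge, ContinuousAlternatingMap.alternatizeUncurryFin_apply]
  refine (Fin.sum_univ_three _).trans ?_
  have h0 : Fin.removeNth 0 v = ![v 1, v 2] := by ext i; fin_cases i <;> rfl
  have h1 : Fin.removeNth 1 v = ![v 0, v 2] := by ext i; fin_cases i <;> rfl
  have h2 : Fin.removeNth 2 v = ![v 0, v 1] := by ext i; fin_cases i <;> rfl
  rw [h0, h1, h2]; simp; ring

theorem wedge_three (α : E →L[ℝ] ℝ) (η : E [⋀^Fin 3]→L[ℝ] ℝ) (v : Fin 4 → E) :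
    wedge α η v = α (v 0) * η ![v 1, v 2, v 3] - α (v 1) * η ![v 0, v 2, v 3]
      + α (v 2) * η ![v 0, v 1, v 3] - α (v 3) * η ![v 0, v 1, v 2] := by
  rw [wedge, ContinuousAlternatingMap.alternatizeUncurryFin_apply]
  refine (Fin.sum_univ_four _).trans ?_
  have h0 : Fin.removeNth 0 v = ![v 1, v 2, v 3] := by ext i; fin_cases i <;> rfl
  have h1 : Fin.removeNth 1 v = ![v 0, v 2, v 3] := by ext i; fin_cases i <;> rfl
  have h2 : Fin.removeNth 2 v = ![v 0, v 1, v 3] := by ext i; fin_cases i <;> rfl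
  have h3 : Fin.removeNth 3 v = ![v 0, v 1, v 2] := by ext i; fin_cases i <;> rfl
  rw [h0, h1, h2, h3]; simp; ring

/-- `3 × 3` matrices of `1`-covectors. -/
abbrev MatCovector₁ (E : Type*) [NormedAddCommGroup E] [NormedSpace ℝ E] : Type _ :=
  Matrix (Fin 3) (Fin 3) (E →L[ℝ] ℝ)

/-- `3 × 3` matrices of `2`-covectors. -/
abbrev MatCovector₂ (E : Type*) [NormedAddCommGroup E] [NormedSpace ℝ E] : Type _ :=
  Matrix (Fin 3) (Fin 3) (E [⋀^Fin 2]→L[ℝ] ℝ)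

/-- The curvature `K = d𝒜 + 𝒜 ∧ 𝒜` of a matrix-valued `1`-form. -/
def curvatureForm (A : E → MatCovector₁ E) (u : E) : MatCovector₂ E :=
  Matrix.of fun i j =>
    extDeriv (fun y => oneForm (A y i j)) u + ∑ k, wedge₁ (A u i k) (A u k j)

/-- The covariant exterior derivative `DΩ = dΩ + 𝒜 ∧ Ω - Ω ∧ 𝒜` of a matrix-valued `2`-form `Ω`;
a `2`-covector commutes with a `1`-covector, so `Ωᵢₖ ∧ 𝒜ₖⱼ = 𝒜ₖⱼ ∧ Ωᵢₖ`. -/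
def covExtDeriv (A : E → MatCovector₁ E) (Ω : E → MatCovector₂ E) (u : E) :
    Matrix (Fin 3) (Fin 3) (E [⋀^Fin 3]→L[ℝ] ℝ) :=
  Matrix.of fun i j =>
    extDeriv (fun y => Ω y i j) u + ∑ k, wedge (A u i k) (Ω u k j) - ∑ k, wedge (A u k j) (Ω u i k)

end Exterior

/-! ### Pseudo-Riemannian geometry of a metric on an open subset of a vector space -/

section Metric

variable (g : E → E →L[ℝ] E →L[ℝ] ℝ)

/-- `koszul g x u v z = ½ (D_u g(v,z) + D_v g(u,z) - D_z g(u,v))`, the Christoffel symbols of the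
first kind. -/
def koszul (x : E) : E →L[ℝ] E →L[ℝ] E →L[ℝ] ℝ :=
  let T : E →L[ℝ] E →L[ℝ] E →L[ℝ] ℝ := fderiv ℝ g x
  let T' : E →L[ℝ] E →L[ℝ] E →L[ℝ] ℝ :=
    (ContinuousLinearMap.flipₗᵢ ℝ E E ℝ).toContinuousLinearEquiv.toContinuousLinearMap.comp T.flip
  let T'' : E →L[ℝ] E →L[ℝ] E →L[ℝ] ℝ := T.flip
  (1 / 2 : ℝ) • (T + T'' - T')

/-- The Christoffel symbols of the Levi-Civita connection, `∇_u v = D_u v + christoffel g x u v`;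
the index is raised with the inverse of `g x : E → E*`. -/
def christoffel (x : E) : E →L[ℝ] E →L[ℝ] E :=
  (ContinuousLinearMap.compL ℝ E (E →L[ℝ] ℝ) E (ContinuousLinearMap.inverse (g x))).comp
    (koszul g x)

/-- The Riemann tensor `R(u,v)w = ∇_u ∇_v w - ∇_v ∇_u w - ∇_[u,v] w`. -/
def riemann (x u v w : E) : E :=
  fderiv ℝ (christoffel g) x u v w - fderiv ℝ (christoffel g) x v u w
    + christoffel g x u (christoffel g x v w) - christoffel g x v (christoffel g x u w)

/-- The Ricci tensor `R_{ab} = R^c_{acb}`, that is `Ric(v,w) = tr (u ↦ R(u,w)v)`. -/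
def ricci (x v w : E) : ℝ :=
  LinearMap.trace ℝ E
    { toFun := fun u => riemann g x u w v
      map_add' := fun a b => by simp only [riemann, map_add, add_apply]; abel
      map_smul' := fun c a => by
        simp only [riemann, map_smul, smul_apply, RingHom.id_apply, smul_add,
          smul_sub] }

/-- The scalar curvature `R = g^{ab} R_{ab}`, with `g^{ab}` the inverse Gram matrix of a basis. -/
def scalarCurvature [FiniteDimensional ℝ E] (x : E) : ℝ :=
  let b := Module.finBasis ℝ E
  ∑ i, ∑ j, (Matrix.of fun k l => g x (b k) (b l))⁻¹ i j * ricci g x (b i) (b j)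

/-- The Schouten tensor `P_{ab} = ½ R_{ab} - (1/12) R g_{ab}`. -/
def schouten [FiniteDimensional ℝ E] (x u v : E) : ℝ :=
  ricci g x u v / 2 - scalarCurvature g x / 12 * g x u v

/-- The Weyl tensor
`C_{abcd} = R_{abcd} + g_{ad} P_{cb} - g_{ac} P_{db} + g_{bc} P_{da} - g_{bd} P_{ca}`, where
`R_{abcd} = g_{ae} R^e_{bcd}` and `R^e_{bcd} = θᵉ(R(e_c, e_d) e_b)`. -/
def weyl [FiniteDimensional ℝ E] (x a b c d : E) : ℝ :=
  g x a (riemann g x c d b) + g x a d * schouten g x c b - g x a c * schouten g x d b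
    + g x b c * schouten g x d a - g x b d * schouten g x c a

end Metric

/-! ### Adapted null frames -/

section Frames

/-- The components `g₁₃ = g₃₁ = g₂₄ = g₄₂ = 1` of the metric `2θ¹θ³ + 2θ²θ⁴`
(with indices `0, 1, 2, 3` in place of `1, 2, 3, 4`). -/
def nullGram (a b : Fin 4) : ℝ := if b = a + 2 then 1 else 0

/-- The eigenvalues of `K` on an adapted frame. -/
def paraSign (a : Fin 4) : ℝ := ![1, 1, -1, -1] a

/-- The vectors `(∂/∂α¹, ∂/∂α², ∂/∂ᾱ¹, ∂/∂ᾱ²)` form a frame at one point that is adapted to the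
inner product `g` and the endomorphism `K`: the dual coframe satisfies `g = 2α¹ᾱ¹ + 2α²ᾱ²` and
`K = α¹⊗∂/∂α¹ + α²⊗∂/∂α² - ᾱ¹⊗∂/∂ᾱ¹ - ᾱ²⊗∂/∂ᾱ²`. -/
structure IsAdaptedFrame (g : E →L[ℝ] E →L[ℝ] ℝ) (K : E →L[ℝ] E) (e : Fin 4 → E) : Prop where
  gram : ∀ a b, g (e a) (e b) = nullGram a b
  eigen : ∀ a, K (e a) = paraSign a • e a

/-- The coframe `(θ¹, θ², θ³, θ⁴) = (α¹, α², ᾱ¹, ᾱ²)` dual to an adapted frame: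
`θ¹ = g(e₃, ·)`, `θ² = g(e₄, ·)`, `θ³ = g(e₁, ·)`, `θ⁴ = g(e₂, ·)`. -/
def coframe (g : E →L[ℝ] E →L[ℝ] ℝ) (e : Fin 4 → E) (a : Fin 4) : E →L[ℝ] ℝ := g (e (a + 2))

theorem coframe_apply_frame {g : E →L[ℝ] E →L[ℝ] ℝ} {K : E →L[ℝ] E} {e : Fin 4 → E}
    (he : IsAdaptedFrame g K e) (a b : Fin 4) :
    coframe g e a (e b) = if a = b then 1 else 0 := by
  rw [coframe, he.gram, nullGram]
  fin_cases a <;> fin_cases b <;> simp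

/-- An adapted frame is a basis and `coframe` is its dual basis. -/
theorem IsAdaptedFrame.expand {g : E →L[ℝ] E →L[ℝ] ℝ} {K : E →L[ℝ] E} {e : Fin 4 → E}
    [FiniteDimensional ℝ E] (he : IsAdaptedFrame g K e) (hdim : Module.finrank ℝ E = 4) (v : E) :
    v = ∑ a, coframe g e a v • e a := by
  have hli : LinearIndependent ℝ e := by
    rw [Fintype.linearIndependent_iff]
    intro c hc a
    have := congrArg (coframe g e a) hc
    simpa [coframe_apply_frame he] using this
  have hv : v ∈ Submodule.span ℝ (Set.range e) := by
    rw [hli.span_eq_top_of_card_eq_finrank' (by simp [hdim])]; trivial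
  obtain ⟨c, rfl⟩ := (Submodule.mem_span_range_iff_exists_fun ℝ).1 hv
  simp [coframe_apply_frame he]

/-- The component `Ψ₂' = C₁₂₃₄` of the self-dual Weyl tensor in an adapted frame. -/
def psiTwoPrime [FiniteDimensional ℝ E] (g : E → E →L[ℝ] E →L[ℝ] ℝ) (x : E) (e : Fin 4 → E) : ℝ :=
  weyl g x (e 0) (e 1) (e 2) (e 3)

/-- The Hodge star on `2`-covectors of `E` for the inner product `g` and the volume form
`vol = α¹ ∧ α² ∧ ᾱ¹ ∧ ᾱ²` of an adapted frame `e`. It is the linear map with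
`*(α¹∧α²) = α¹∧α²`, `*(ᾱ¹∧ᾱ²) = ᾱ¹∧ᾱ²`, `*(α¹∧ᾱ¹) = α²∧ᾱ²`, `*(α²∧ᾱ²) = α¹∧ᾱ¹`,
`*(α¹∧ᾱ²) = -α¹∧ᾱ²`, `*(α²∧ᾱ¹) = -α²∧ᾱ¹`. -/
def hodgeStar (g : E →L[ℝ] E →L[ℝ] ℝ) (e : Fin 4 → E) (η : E [⋀^Fin 2]→L[ℝ] ℝ) :
    E [⋀^Fin 2]→L[ℝ] ℝ :=
  let θ := coframe g e
  η ![e 0, e 1] • wedge₁ (θ 0) (θ 1) + η ![e 2, e 3] • wedge₁ (θ 2) (θ 3)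
    + η ![e 0, e 2] • wedge₁ (θ 1) (θ 3) + η ![e 1, e 3] • wedge₁ (θ 0) (θ 2)
    - η ![e 0, e 3] • wedge₁ (θ 0) (θ 3) - η ![e 1, e 2] • wedge₁ (θ 1) (θ 2)

/-- `*η(X, Y) vol = η ∧ X♭ ∧ Y♭`, evaluated on the frame `e`, on which `vol` takes the value `1`
(the `2`-covector `η` commutes with the `1`-covectors `X♭ = g(X, ·)` and `Y♭ = g(Y, ·)`). -/
theorem hodgeStar_spec {g : E →L[ℝ] E →L[ℝ] ℝ} {e : Fin 4 → E}
    (hs : ∀ v w, g v w = g w v) (η : E [⋀^Fin 2]→L[ℝ] ℝ) (X Y : E) :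
    hodgeStar g e η ![X, Y] = wedge (g X) (wedge (g Y) η) e := by
  rw [wedge_three]
  simp only [wedge_two]
  have hX : ∀ a, g (e a) X = g X (e a) := fun a => hs _ _
  have hY : ∀ a, g (e a) Y = g Y (e a) := fun a => hs _ _
  simp [hodgeStar, wedge₁_apply, coframe, hX, hY]
  ring

end Frames

/-! ### The bundle of adapted frames and its Cartan connection

Over an open set on which a smooth adapted frame `e = (e₁, e₂, e₃, e₄)` is given, the bundle `ℱ⁸` of
adapted frames is identified with an open subset of `E × M₂(ℝ)`: the pair `(x, a)` with
`a ∈ GL₂(ℝ)` stands for the adapted frame `frameAt e (x, a)` at `x`. -/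

section Bundle

/-- The space `E × M₂(ℝ)`, in which the bundle charts of `ℱ⁸` take their values. -/
abbrev FrameModel (E : Type*) : Type _ := E × (Fin 2 → Fin 2 → ℝ)

/-- The part `{(x, a) | x ∈ W, det a ≠ 0}` of `ℱ⁸` lying over `W`. -/
def frameBundle (W : Set E) : Set (FrameModel E) := {u | u.1 ∈ W ∧ (Matrix.of u.2).det ≠ 0}

/-- The projection `dπ` of the tangent spaces of `ℱ⁸` to those of the base. -/
def projBase : FrameModel E →L[ℝ] E := ContinuousLinearMap.fst ℝ E (Fin 2 → Fin 2 → ℝ)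

/-- The adapted frame at `x` that the point `u = (x, a)` of `ℱ⁸` stands for: the matrix `a` acts on
`(∂/∂α¹, ∂/∂α²)` and its inverse transpose on `(∂/∂ᾱ¹, ∂/∂ᾱ²)`. -/
def frameAt (e : Fin 4 → E → E) (u : FrameModel E) : Fin 4 → E :=
  let x := u.1
  let a := Matrix.of u.2
  ![a 0 0 • e 0 x + a 1 0 • e 1 x,
    a 0 1 • e 0 x + a 1 1 • e 1 x,
    a⁻¹ 0 0 • e 2 x + a⁻¹ 0 1 • e 3 x,
    a⁻¹ 1 0 • e 2 x + a⁻¹ 1 1 • e 3 x]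

/-- The frame that `u` stands for is adapted. -/
theorem isAdaptedFrame_frameAt {g : E → E →L[ℝ] E →L[ℝ] ℝ} {K : E → E →L[ℝ] E} {e : Fin 4 → E → E}
    {u : FrameModel E} (he : IsAdaptedFrame (g u.1) (K u.1) fun c => e c u.1)
    (hu : (Matrix.of u.2).det ≠ 0) :
    IsAdaptedFrame (g u.1) (K u.1) (frameAt e u) := by
  have h := he.gram
  have hk := he.eigen
  simp only [nullGram] at h
  have e1 : (Matrix.of u.2)⁻¹ * Matrix.of u.2 = 1 :=
    Matrix.nonsing_inv_mul _ (isUnit_iff_ne_zero.2 hu)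
  have e2 := fun i j => congrFun (congrFun e1 i) j
  simp only [Matrix.mul_apply, Fin.sum_univ_two] at e2
  have e00 := e2 0 0
  have e01 := e2 0 1
  have e10 := e2 1 0
  have e11 := e2 1 1
  simp at e00 e01 e10 e11
  constructor
  · intro a b
    fin_cases a <;> fin_cases b <;>
      simp [frameAt, nullGram, h] <;> linarith
  · intro a
    fin_cases a <;> simp [frameAt, hk, paraSign, smul_comm (-1 : ℝ)]

/-- Every adapted frame at `x` is `frameAt e (x, a)` for exactly one `a ∈ GL₂(ℝ)`. -/
theorem exists_frameAt_eq {g : E → E →L[ℝ] E →L[ℝ] ℝ} {K : E → E →L[ℝ] E} {e : Fin 4 → E → E}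
    [FiniteDimensional ℝ E] {x : E} (hdim : Module.finrank ℝ E = 4) (he : IsAdaptedFrame (g x) (K x) fun c => e c x)
    {f : Fin 4 → E} (hf : IsAdaptedFrame (g x) (K x) f) :
    ∃! a : Fin 2 → Fin 2 → ℝ, (Matrix.of a).det ≠ 0 ∧ frameAt e (x, a) = f := by
  set θ := coframe (g x) (fun c => e c x) with hθ
  have hK : ∀ a b, paraSign b * θ b (f a) = paraSign a * θ b (f a) := by
    intro a b
    have h1 := congrArg (θ b) (hf.eigen a)
    rw [he.expand hdim (f a)] at h1
    simp only [map_sum, map_smul, he.eigen] at h1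
    simp only [← hθ, hθ ▸ coframe_apply_frame he] at h1
    simpa [mul_comm] using h1
  have hz : ∀ a b, paraSign a ≠ paraSign b → θ b (f a) = 0 := by
    intro a b hab
    have := hK a b
    rw [← sub_eq_zero, ← sub_mul, mul_eq_zero] at this
    rcases this with h | h
    · exact absurd (sub_eq_zero.1 h).symm hab
    · exact h
  have hpm : (1 : ℝ) ≠ -1 := by norm_num
  have hmp : (-1 : ℝ) ≠ 1 := by norm_num
  have ex : ∀ a, f a = θ 0 (f a) • e 0 x + θ 1 (f a) • e 1 x + θ 2 (f a) • e 2 x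
      + θ 3 (f a) • e 3 x := by
    intro a
    have := he.expand hdim (f a)
    rwa [Fin.sum_univ_four] at this
  have f0 := ex 0
  have f1 := ex 1
  have f2 := ex 2
  have f3 := ex 3
  rw [hz 0 2 hpm, hz 0 3 hpm, zero_smul, zero_smul, add_zero,
    add_zero] at f0
  rw [hz 1 2 hpm, hz 1 3 hpm, zero_smul, zero_smul, add_zero,
    add_zero] at f1
  rw [hz 2 0 hmp, hz 2 1 hmp, zero_smul, zero_smul, zero_add,
    zero_add] at f2
  rw [hz 3 0 hmp, hz 3 1 hmp, zero_smul, zero_smul, zero_add,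
    zero_add] at f3
  have hg := he.gram
  have gf := hf.gram
  simp only [nullGram] at hg gf
  have g02 := gf 0 2
  have g03 := gf 0 3
  have g12 := gf 1 2
  have g13 := gf 1 3
  rw [f0, f2] at g02
  rw [f0, f3] at g03
  rw [f1, f2] at g12
  rw [f1, f3] at g13
  simp [hg] at g02 g03 g12 g13
  have hinv : Matrix.of ![![θ 2 (f 2), θ 3 (f 2)], ![θ 2 (f 3), θ 3 (f 3)]] *
      Matrix.of ![![θ 0 (f 0), θ 0 (f 1)], ![θ 1 (f 0), θ 1 (f 1)]] = 1 := by
    ext i j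
    fin_cases i <;> fin_cases j <;> simp [Matrix.mul_apply] <;> linarith
  refine ⟨![![θ 0 (f 0), θ 0 (f 1)], ![θ 1 (f 0), θ 1 (f 1)]], ⟨?_, ?_⟩, ?_⟩
  · exact (Matrix.isUnit_det_of_left_inverse hinv).ne_zero
  · funext c
    have hi := Matrix.inv_eq_left_inv hinv
    fin_cases c <;> simp only [frameAt, hi] <;> simp
    · exact f0.symm
    · exact f1.symm
    · exact f2.symm
    · exact f3.symm
  · rintro b ⟨-, hb⟩
    have h0 := congrFun hb 0
    have h1 := congrFun hb 1
    have c1 := he.gram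
    ext i j
    have k0 := congrArg (θ 0) h0
    have k1 := congrArg (θ 1) h0
    have l0 := congrArg (θ 0) h1
    have l1 := congrArg (θ 1) h1
    have d := hθ ▸ coframe_apply_frame he
    simp [frameAt, d] at k0 k1 l0 l1
    fin_cases i <;> fin_cases j
    · exact k0
    · exact l0
    · exact k1
    · exact l1

/-- The tautological `1`-forms `(θ¹, θ², θ³, θ⁴) = (α¹, α², ᾱ¹, ᾱ²)` on `ℱ⁸`: at the frame `u` they
are the pullback of the coframe dual to `u`. -/
def tautForm (g : E → E →L[ℝ] E →L[ℝ] ℝ) (e : Fin 4 → E → E) (u : FrameModel E) (c : Fin 4) :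
    FrameModel E →L[ℝ] ℝ :=
  (coframe (g u.1) (frameAt e u) c).comp projBase

/-- The Levi-Civita connection forms `Γᵃ_b` on `ℱ⁸`: `Γᵃ_b(ξ) = θᵃ(∇_ξ e_b)`, where `e_b` is the
`b`-th vector of the frame `u`, a vector field along the projection `ℱ⁸ → M`. -/
def connectionForm (g : E → E →L[ℝ] E →L[ℝ] ℝ) (e : Fin 4 → E → E) (u : FrameModel E)
    (c b : Fin 4) : FrameModel E →L[ℝ] ℝ :=
  (coframe (g u.1) (frameAt e u) c).comp
    (fderiv ℝ (fun w => frameAt e w b) u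
      + ((christoffel g u.1).flip (frameAt e u b)).comp projBase)

/-- The `𝔰𝔩₃(ℝ)`-valued Cartan connection
`𝒜 = [[Γ - ⅓ tr Γ, α], [ᾱ, -⅓ tr Γ]]` on `ℱ⁸`. -/
def cartanConnection (g : E → E →L[ℝ] E →L[ℝ] ℝ) (e : Fin 4 → E → E) (u : FrameModel E) :
    MatCovector₁ (FrameModel E) :=
  let Γ := connectionForm g e u
  let θ := tautForm g e u
  let t := (1 / 3 : ℝ) • (Γ 0 0 + Γ 1 1)
  !![Γ 0 0 - t, Γ 0 1, θ 0;
     Γ 1 0, Γ 1 1 - t, θ 1;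
     θ 2, θ 3, -t]

/-- The curvature `K_𝒜 = d𝒜 + 𝒜 ∧ 𝒜` on `ℱ⁸`. -/
def cartanCurvature (g : E → E →L[ℝ] E →L[ℝ] ℝ) (e : Fin 4 → E → E) (u : FrameModel E) :
    MatCovector₂ (FrameModel E) :=
  curvatureForm (cartanConnection g e) u

/-- The Hodge star of a horizontal `2`-covector on `ℱ⁸`, i.e. of the pullback of a `2`-covector of
the base: the pullback of the Hodge star of the base. -/
def horizontalStar (g : E → E →L[ℝ] E →L[ℝ] ℝ) (e : Fin 4 → E → E) (u : FrameModel E)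
    (η : FrameModel E [⋀^Fin 2]→L[ℝ] ℝ) : FrameModel E [⋀^Fin 2]→L[ℝ] ℝ :=
  (hodgeStar (g u.1) (frameAt e u)
    (η.compContinuousLinearMap (ContinuousLinearMap.inl ℝ E _))).compContinuousLinearMap projBase

/-- The matrix-valued `2`-form `*K_𝒜` on `ℱ⁸`. -/
def starCurvature (g : E → E →L[ℝ] E →L[ℝ] ℝ) (e : Fin 4 → E → E) (u : FrameModel E) :
    MatCovector₂ (FrameModel E) :=
  Matrix.of fun i j => horizontalStar g e u (cartanCurvature g e u i j)

end Bundle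

/-! ### Almost para-Hermitian 4-manifolds -/

section Manifold

variable {M : Type*} [TopologicalSpace M] [ChartedSpace E M]

/-- A field of bilinear forms on a 4-manifold, written in the chart `φ`. -/
def localBilin (g : ∀ p : M, TangentSpace 𝓘(ℝ, E) p →L[ℝ] TangentSpace 𝓘(ℝ, E) p →L[ℝ] ℝ)
    (φ : OpenPartialHomeomorph M E) (x : E) : E →L[ℝ] E →L[ℝ] ℝ :=
  let D : E →L[ℝ] E := mfderiv 𝓘(ℝ, E) 𝓘(ℝ, E) φ.symm x
  let G : E →L[ℝ] E →L[ℝ] ℝ := g (φ.symm x)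
  G.bilinearComp D D

/-- A field of endomorphisms on a 4-manifold, written in the chart `φ`. -/
def localEndo (K : ∀ p : M, TangentSpace 𝓘(ℝ, E) p →L[ℝ] TangentSpace 𝓘(ℝ, E) p)
    (φ : OpenPartialHomeomorph M E) (x : E) : E →L[ℝ] E :=
  let D : E →L[ℝ] TangentSpace 𝓘(ℝ, E) (φ.symm x) := mfderiv 𝓘(ℝ, E) 𝓘(ℝ, E) φ.symm x
  let D' : TangentSpace 𝓘(ℝ, E) (φ.symm x) →L[ℝ] E := mfderiv 𝓘(ℝ, E) 𝓘(ℝ, E) φ (φ.symm x)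
  (D'.comp (K (φ.symm x))).comp D

variable (E M) in
/-- A (smooth) almost para-Hermitian structure `(M, g, K)` on a 4-manifold: a metric `g` of
signature `(+,+,-,-)` and an endomorphism field `K` with `K² = id`, `±1`-eigenspaces of rank 2 and
`g(KX, KY) = -g(X, Y)`. -/
structure AlmostParaHermitian where
  g : ∀ p : M, TangentSpace 𝓘(ℝ, E) p →L[ℝ] TangentSpace 𝓘(ℝ, E) p →L[ℝ] ℝ
  K : ∀ p : M, TangentSpace 𝓘(ℝ, E) p →L[ℝ] TangentSpace 𝓘(ℝ, E) p
  symm : ∀ p (v w : TangentSpace 𝓘(ℝ, E) p), g p v w = g p w v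
  signature : ∀ p, ∃ b : Module.Basis (Fin 4) ℝ (TangentSpace 𝓘(ℝ, E) p),
    ∀ i j, g p (b i) (b j) = if i = j then ![1, 1, -1, -1] i else 0
  K_sq : ∀ p (v : TangentSpace 𝓘(ℝ, E) p), K p (K p v) = v
  finrank_pos : ∀ p, Module.finrank ℝ
    (Module.End.eigenspace (K p : TangentSpace 𝓘(ℝ, E) p →ₗ[ℝ] TangentSpace 𝓘(ℝ, E) p) 1) = 2
  finrank_neg : ∀ p, Module.finrank ℝ
    (Module.End.eigenspace (K p : TangentSpace 𝓘(ℝ, E) p →ₗ[ℝ] TangentSpace 𝓘(ℝ, E) p) (-1)) = 2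
  compat : ∀ p (v w : TangentSpace 𝓘(ℝ, E) p), g p (K p v) (K p w) = -g p v w
  smooth_g : ∀ φ ∈ atlas E M, ContDiffOn ℝ ∞ (localBilin g φ) φ.target
  smooth_K : ∀ φ ∈ atlas E M, ContDiffOn ℝ ∞ (localEndo K φ) φ.target

/-- The distribution of `ε`-eigenspaces of `K` on the open set `V` is integrable: the bracket of two
of its smooth local sections is again a section. -/
def IsIntegrableEigendistribution (K : E → E →L[ℝ] E) (V : Set E) (ε : ℝ) : Prop :=
  ∀ W ⊆ V, IsOpen W → ∀ X Y : E → E, ContDiffOn ℝ ∞ X W → ContDiffOn ℝ ∞ Y W →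
    (∀ x ∈ W, K x (X x) = ε • X x) → (∀ x ∈ W, K x (Y x) = ε • Y x) →
      ∀ x ∈ W, K x (VectorField.lieBracket ℝ X Y x) = ε • VectorField.lieBracket ℝ X Y x

/-- The para-Kähler form `ρ(X, Y) = g(KX, Y)`. As `ρ` is skew, it is half of the alternatization
`ρ(X, Y) - ρ(Y, X)`, which makes it an alternating map. -/
def paraKahlerForm (g : E → E →L[ℝ] E →L[ℝ] ℝ) (K : E → E →L[ℝ] E) (x : E) :
    E [⋀^Fin 2]→L[ℝ] ℝ :=
  (1 / 2 : ℝ) • ContinuousAlternatingMap.alternatizeUncurryFin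
    ((ContinuousAlternatingMap.ofSubsingletonLIE (𝕜 := ℝ) (E := E) (F := ℝ)
      (0 : Fin 1)).toContinuousLinearEquiv.toContinuousLinearMap.comp ((g x).comp (K x)))

/-- `e` is a smooth frame on `W` that is adapted to `(g, K)` at every point. -/
structure IsAdaptedFrameOn (g : E → E →L[ℝ] E →L[ℝ] ℝ) (K : E → E →L[ℝ] E) (W : Set E)
    (e : Fin 4 → E → E) : Prop where
  smooth : ∀ a, ContDiffOn ℝ ∞ (e a) W
  adapted : ∀ x ∈ W, IsAdaptedFrame (g x) (K x) fun a => e a x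

namespace AlmostParaHermitian

variable (S : AlmostParaHermitian E M)

/-- `(M, g, K)` is para-Kähler: both eigendistributions of `K` are integrable and `dρ = 0`. -/
structure IsParaKahler : Prop where
  integrable_pos : ∀ φ ∈ atlas E M, IsIntegrableEigendistribution (localEndo S.K φ) φ.target 1
  integrable_neg : ∀ φ ∈ atlas E M, IsIntegrableEigendistribution (localEndo S.K φ) φ.target (-1)
  closed : ∀ φ ∈ atlas E M, ∀ x ∈ φ.target,
    extDeriv (paraKahlerForm (localBilin S.g φ) (localEndo S.K φ)) x = 0

/-- The metric is Einstein: its trace-free Ricci tensor `R_{ab} - ¼ R g_{ab}` vanishes. -/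
def IsEinstein [FiniteDimensional ℝ E] : Prop :=
  ∀ φ ∈ atlas E M, ∀ x ∈ φ.target, ∀ v w : E,
    ricci (localBilin S.g φ) x v w
      - scalarCurvature (localBilin S.g φ) x / 4 * localBilin S.g φ x v w = 0

/-- The scalar invariant `Ψ₂'` has the value `c` at `p` (in any chart around `p` and any adapted
frame at `p`). -/
def HasPsiTwoPrime [FiniteDimensional ℝ E] (p : M) (c : ℝ) : Prop :=
  ∀ φ ∈ atlas E M, p ∈ φ.source → ∀ e : Fin 4 → E,
    IsAdaptedFrame (localBilin S.g φ (φ p)) (localEndo S.K φ (φ p)) e →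
      psiTwoPrime (localBilin S.g φ) (φ p) e = c

/-- A property of points of the adapted frame bundle `ℱ⁸`, given in terms of a bundle chart (a local
metric `g`, a smooth adapted frame `e` and a point `u` of `E × GL₂(ℝ)`), holds on all of `ℱ⁸`. -/
def OnFrameBundle
    (P : (E → E →L[ℝ] E →L[ℝ] ℝ) → (Fin 4 → E → E) → FrameModel E → Prop) : Prop :=
  ∀ φ ∈ atlas E M, ∀ W ⊆ φ.target, IsOpen W → ∀ e : Fin 4 → E → E,
    IsAdaptedFrameOn (localBilin S.g φ) (localEndo S.K φ) W e →
      ∀ u ∈ frameBundle W, P (localBilin S.g φ) e u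

/-- The Yang–Mills equations `D * K_𝒜 = 0` on `ℱ⁸`. -/
def SatisfiesYangMills : Prop :=
  S.OnFrameBundle fun g e u => covExtDeriv (cartanConnection g e) (starCurvature g e) u = 0

/-- The curvature of the Cartan connection is anti-self-dual: `*K_𝒜 = -K_𝒜` on `ℱ⁸`. -/
def HasAntiSelfDualCurvature : Prop :=
  S.OnFrameBundle fun g e u => starCurvature g e u = -cartanCurvature g e u

/-- The Bianchi identity `D K_𝒜 = 0` on `ℱ⁸`. -/
def SatisfiesBianchi : Prop :=
  S.OnFrameBundle fun g e u => covExtDeriv (cartanConnection g e) (cartanCurvature g e) u = 0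

end AlmostParaHermitian

end Manifold

end

end ParaKahler

open scoped Topology

namespace ParaKahler

variable {E : Type*} [NormedAddCommGroup E] [NormedSpace ℝ E]

/-! ### Product rules -/

section ProductRules

variable {U F G H : Type*} [NormedAddCommGroup U] [NormedSpace ℝ U] [NormedAddCommGroup F]
  [NormedSpace ℝ F] [NormedAddCommGroup G] [NormedSpace ℝ G] [NormedAddCommGroup H]
  [NormedSpace ℝ H]

/-! Everything rests on one formula on the frame bundle, `starCurvature_apply`: *K_𝒜 = -K_𝒜 + (1 -
Ψ₂') diag(1, 1, -2) ω, where ω = α¹∧ᾱ¹ + α²∧ᾱ².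

To obtain it, integrability and dρ = 0 are turned into ∇K = 0 (`covDerivEndo_eq_zero`). Hence Γ
preserves the two eigendistributions, and by the pair symmetry of the Riemann tensor the curvature
forms Ω of Γ have type (1,1), that is, no α¹∧α² or ᾱ¹∧ᾱ² component. The first structure equation
cancels the entries of K_𝒜 in the places of α and ᾱ; what remains is Ω - ⅓ tr Ω + α∧ᾱ in the 2×2
block and -⅓ tr Ω + ᾱ∧α in the corner (`cartanCurvature_apply`). On forms of type (1,1) the Hodge
star is -1 on the ω-trace-free part and +1 on ω (`hodgeStar_eq_neg_add`), so only the ω-trace of K_𝒜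
matters. The Einstein condition, with Λ = R/4, makes the ω-trace of Ω equal to Λ id, while Ψ₂' =
-Λ/3 (`psiTwoPrime_eq`); thus the ω-trace of K_𝒜 is (1 + Λ/3) diag(1, 1, -2).

Since ω ≠ 0, anti-self-duality at a point means Ψ₂' = 1 there. If Ψ₂' = 1 everywhere, then D*K_𝒜 =
-DK_𝒜 = 0 by the Bianchi identity, which holds for any matrix-valued 1-form
(`covExtDeriv_curvatureForm`). Conversely, adding the Bianchi identity to the Yang–Mills equations
and reading off the entry in the place of α¹ leaves -3(1 - Ψ₂') α¹∧ω = 0. The correction term is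
diagonal, so this entry involves no derivative of Ψ₂'.

The structure equations are proved for an adapted frame along any linear projection, and are then
applied to the tautological frame on the frame bundle. Passing between bundle charts and points of M
uses that every adapted frame at a point extends to a local one (`exists_adaptedFrameOn`). -/

theorem fderiv_eval {T : U → F →L[ℝ] G} {a : U → F} {x : U} (hT : DifferentiableAt ℝ T x)
    (ha : DifferentiableAt ℝ a x) (u : U) :
    fderiv ℝ (fun y => T y (a y)) x u = fderiv ℝ T x u (a x) + T x (fderiv ℝ a x u) := by
  rw [fderiv_clm_apply hT ha]
  simp [add_comm]

theorem fderiv_eval_const {T : U → F →L[ℝ] G} {x : U} (hT : DifferentiableAt ℝ T x) (v : F)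
    (u : U) : fderiv ℝ (fun y => T y v) x u = fderiv ℝ T x u v := by
  simpa using fderiv_eval hT (differentiableAt_const v) u

theorem fderiv_eval₂ {T : U → F →L[ℝ] G →L[ℝ] H} {a : U → F} {b : U → G} {x : U}
    (hT : DifferentiableAt ℝ T x) (ha : DifferentiableAt ℝ a x) (hb : DifferentiableAt ℝ b x)
    (u : U) :
    fderiv ℝ (fun y => T y (a y) (b y)) x u =
      fderiv ℝ T x u (a x) (b x) + T x (fderiv ℝ a x u) (b x) + T x (a x) (fderiv ℝ b x u) := by
  rw [fderiv_eval (T := fun y => T y (a y)) (hT.clm_apply ha) hb, fderiv_eval hT ha]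
  simp

theorem fderiv_eval₂_const {T : U → F →L[ℝ] G →L[ℝ] H} {x : U} (hT : DifferentiableAt ℝ T x)
    (v : F) (w : G) (u : U) : fderiv ℝ (fun y => T y v w) x u = fderiv ℝ T x u v w := by
  simpa using fderiv_eval₂ hT (differentiableAt_const v) (differentiableAt_const w) u

/-- Functions that agree near a point have the same directional derivatives there. -/
theorem fderiv_congr {f f' : U → F} {x : U} (h : f =ᶠ[𝓝 x] f') (u : U) :
    fderiv ℝ f x u = fderiv ℝ f' x u := by rw [h.fderiv_eq]

end ProductRules

/-! ### Exterior derivatives of forms of low degree -/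

theorem alternatizeUncurryFin_two (T : E →L[ℝ] E [⋀^Fin 2]→L[ℝ] ℝ) (u v w : E) :
    ContinuousAlternatingMap.alternatizeUncurryFin T ![u, v, w] =
      T u ![v, w] - T v ![u, w] + T w ![u, v] := by
  rw [ContinuousAlternatingMap.alternatizeUncurryFin_apply]
  refine (Fin.sum_univ_three _).trans ?_
  have h0 : Fin.removeNth 0 ![u, v, w] = ![v, w] := by ext i; fin_cases i <;> rfl
  have h1 : Fin.removeNth 1 ![u, v, w] = ![u, w] := by ext i; fin_cases i <;> rfl
  have h2 : Fin.removeNth 2 ![u, v, w] = ![u, v] := by ext i; fin_cases i <;> rfl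
  rw [h0, h1, h2]; simp; ring

theorem extDeriv_two_apply {η : E → E [⋀^Fin 2]→L[ℝ] ℝ} {x : E} (hη : DifferentiableAt ℝ η x)
    (u v w : E) :
    extDeriv η x ![u, v, w] = fderiv ℝ (fun y => η y ![v, w]) x u
      - fderiv ℝ (fun y => η y ![u, w]) x v + fderiv ℝ (fun y => η y ![u, v]) x w := by
  have e : ∀ m z, fderiv ℝ (fun y => η y m) x z = fderiv ℝ η x z m := fun m z => by
    rw [fderiv_continuousAlternatingMap_apply_const_apply hη]
  rw [extDeriv, alternatizeUncurryFin_two]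
  simp only [e]

theorem extDeriv_oneForm_apply {α : E → E →L[ℝ] ℝ} {x : E} (hα : DifferentiableAt ℝ α x)
    (m : Fin 2 → E) :
    extDeriv (fun y => oneForm (α y)) x m
      = fderiv ℝ α x (m 0) (m 1) - fderiv ℝ α x (m 1) (m 0) := by
  have e : fderiv ℝ (fun y => oneForm (α y)) x =
      (ContinuousAlternatingMap.ofSubsingletonLIE (𝕜 := ℝ) (E := E) (F := ℝ)
        (0 : Fin 1)).toContinuousLinearEquiv.toContinuousLinearMap.comp (fderiv ℝ α x) :=
    ((ContinuousAlternatingMap.ofSubsingletonLIE (𝕜 := ℝ) (E := E) (F := ℝ)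
      (0 : Fin 1)).toContinuousLinearEquiv.toContinuousLinearMap.hasFDerivAt.comp x
        hα.hasFDerivAt).fderiv
  rw [extDeriv, e, ContinuousAlternatingMap.alternatizeUncurryFin_apply]
  refine (Fin.sum_univ_two _).trans ?_
  simp [Fin.removeNth_apply, sub_eq_add_neg]
  rfl

/-! ### The Levi-Civita connection of a local metric -/

/-- `g` is a smooth pseudo-Riemannian metric on the open set `V`. -/
structure IsMetricOn (g : E → E →L[ℝ] E →L[ℝ] ℝ) (V : Set E) : Prop where
  isOpen : IsOpen V
  smooth : ContDiffOn ℝ ∞ g V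
  symm : ∀ x ∈ V, ∀ v w, g x v w = g x w v
  nondegenerate : ∀ x ∈ V, (g x).IsInvertible

theorem koszul_apply (g : E → E →L[ℝ] E →L[ℝ] ℝ) (x u v z : E) :
    koszul g x u v z =
      1 / 2 * (fderiv ℝ g x u v z + fderiv ℝ g x v u z - fderiv ℝ g x z u v) := by
  simp [koszul]

namespace IsMetricOn

variable {g : E → E →L[ℝ] E →L[ℝ] ℝ} {V : Set E} (h : IsMetricOn g V) {x : E} (hx : x ∈ V)

include h hx

theorem contDiffAt : ContDiffAt ℝ ∞ g x :=
  h.smooth.contDiffAt (h.isOpen.mem_nhds hx)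

theorem differentiableAt : DifferentiableAt ℝ g x :=
  (h.contDiffAt hx).differentiableAt (by simp)

theorem fderiv_symm (u v w : E) : fderiv ℝ g x u v w = fderiv ℝ g x u w v := by
  have hd := h.differentiableAt hx
  have h1 : (fun y => g y v w) =ᶠ[𝓝 x] fun y => g y w v := by
    filter_upwards [h.isOpen.mem_nhds hx] with y hy using h.symm y hy v w
  simpa only [fderiv_eval₂_const hd] using fderiv_congr h1 u

theorem metric_christoffel (u v z : E) : g x (christoffel g x u v) z = koszul g x u v z := by
  rw [christoffel, ContinuousLinearMap.comp_apply, ContinuousLinearMap.compL_apply,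
    ContinuousLinearMap.comp_apply, (h.nondegenerate x hx).self_apply_inverse]

theorem christoffel_symm (u v : E) : christoffel g x u v = christoffel g x v u := by
  apply (h.nondegenerate x hx).injective
  ext z
  rw [h.metric_christoffel hx, h.metric_christoffel hx, koszul_apply, koszul_apply,
    h.fderiv_symm hx z u v]
  ring

/-- Metric compatibility ∇g = 0, solved for the derivative of the metric. -/
theorem fderiv_eq (u v w : E) :
    fderiv ℝ g x u v w = g x (christoffel g x u v) w + g x v (christoffel g x u w) := by
  rw [h.symm x hx v, h.metric_christoffel hx, h.metric_christoffel hx, koszul_apply, koszul_apply,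
    h.fderiv_symm hx u v w, h.fderiv_symm hx v u w, h.fderiv_symm hx w u v]
  ring

variable [CompleteSpace E]

theorem contDiffAt_christoffel : ContDiffAt ℝ ∞ (christoffel g) x := by
  have hg := h.contDiffAt hx
  have hT : ContDiffAt ℝ ∞ (fderiv ℝ g) x := hg.fderiv_right (by simp)
  have hi : ContDiffAt ℝ ∞ (fun y => ContinuousLinearMap.inverse (g y)) x :=
    ((h.nondegenerate x hx).contDiffAt_map_inverse).comp x hg
  have hf : ContDiffAt ℝ ∞ (fun y => (fderiv ℝ g y).flip) x :=
    ((ContinuousLinearMap.flipₗᵢ ℝ E E (E →L[ℝ] ℝ)).contDiff.contDiffAt).comp x hT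
  have hk : ContDiffAt ℝ ∞ (koszul g) x := by
    unfold koszul
    have hf' : ContDiffAt ℝ ∞ (fun y => (ContinuousLinearMap.flipₗᵢ ℝ E E
        ℝ).toContinuousLinearEquiv.toContinuousLinearMap.comp (fderiv ℝ g y).flip) x :=
      contDiffAt_const.clm_comp hf
    have hs : ContDiffAt ℝ ∞ (fun y => fderiv ℝ g y + (fderiv ℝ g y).flip -
      (ContinuousLinearMap.flipₗᵢ ℝ E E
        ℝ).toContinuousLinearEquiv.toContinuousLinearMap.comp (fderiv ℝ g y).flip) x :=
      (hT.add hf).sub hf'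
    exact hs.const_smul (1 / 2 : ℝ)
  unfold christoffel
  exact ((ContinuousLinearMap.compL ℝ E (E →L[ℝ] ℝ) E).contDiff.contDiffAt.comp x hi).clm_comp hk

theorem fderiv_christoffel_symm (u v w : E) :
    fderiv ℝ (christoffel g) x u v w = fderiv ℝ (christoffel g) x u w v := by
  have hd : DifferentiableAt ℝ (christoffel g) x :=
    (h.contDiffAt_christoffel hx).differentiableAt (by simp)
  have h1 : (fun y => christoffel g y v w) =ᶠ[𝓝 x] fun y => christoffel g y w v := by
    filter_upwards [h.isOpen.mem_nhds hx] with y hy using h.christoffel_symm hy v w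
  simpa only [fderiv_eval₂_const hd] using fderiv_congr h1 u

theorem riemann_bianchi (u v w : E) :
    riemann g x u v w + riemann g x v w u + riemann g x w u v = 0 := by
  simp only [riemann]
  rw [h.fderiv_christoffel_symm hx u v w, h.fderiv_christoffel_symm hx v u w,
    h.fderiv_christoffel_symm hx w u v, h.christoffel_symm hx v w, h.christoffel_symm hx u w,
    h.christoffel_symm hx u v]
  abel

end IsMetricOn

theorem riemann_antisymm (g : E → E →L[ℝ] E →L[ℝ] ℝ) (x u v w : E) :
    riemann g x u v w = -riemann g x v u w := by
  simp only [riemann]; abel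

/-! ### Para-Kähler structures are parallel -/

/-- `(g, K)` is a smooth almost para-Hermitian structure on the open set `V`. -/
structure IsParaHermitianOn (g : E → E →L[ℝ] E →L[ℝ] ℝ) (K : E → E →L[ℝ] E) (V : Set E) : Prop
    extends IsMetricOn g V where
  smooth_endo : ContDiffOn ℝ ∞ K V
  endo_sq : ∀ x ∈ V, ∀ v, K x (K x v) = v
  compat : ∀ x ∈ V, ∀ v w, g x (K x v) (K x w) = -g x v w

/-- The covariant derivative of the endomorphism field `K`. -/
noncomputable def covDerivEndo (g : E → E →L[ℝ] E →L[ℝ] ℝ) (K : E → E →L[ℝ] E) (x u v : E) : E :=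
  fderiv ℝ K x u v + christoffel g x u (K x v) - K x (christoffel g x u v)

theorem covDerivEndo_add_left (g : E → E →L[ℝ] E →L[ℝ] ℝ) (K : E → E →L[ℝ] E) (x u u' v : E) :
    covDerivEndo g K x (u + u') v = covDerivEndo g K x u v + covDerivEndo g K x u' v := by
  simp only [covDerivEndo, map_add, add_apply]; abel

theorem covDerivEndo_add_right (g : E → E →L[ℝ] E →L[ℝ] ℝ) (K : E → E →L[ℝ] E) (x u v v' : E) :
    covDerivEndo g K x u (v + v') = covDerivEndo g K x u v + covDerivEndo g K x u v' := by
  simp only [covDerivEndo, map_add]; abel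

namespace IsParaHermitianOn

variable {g : E → E →L[ℝ] E →L[ℝ] ℝ} {K : E → E →L[ℝ] E} {V : Set E}
  (h : IsParaHermitianOn g K V) {x : E} (hx : x ∈ V)

include h hx

theorem differentiableAt_endo : DifferentiableAt ℝ K x :=
  (h.smooth_endo.contDiffAt (h.isOpen.mem_nhds hx)).differentiableAt (by simp)

theorem metric_endo_left (v w : E) : g x (K x v) w = -g x v (K x w) := by
  rw [← h.compat x hx v (K x w), h.endo_sq x hx]

theorem fderiv_endo_anticomm (u v : E) :
    fderiv ℝ K x u (K x v) + K x (fderiv ℝ K x u v) = 0 := by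
  have hd := h.differentiableAt_endo hx
  have h1 : (fun y => K y (K y v)) =ᶠ[𝓝 x] fun _ => v := by
    filter_upwards [h.isOpen.mem_nhds hx] with y hy using h.endo_sq y hy v
  have h2 := fderiv_congr h1 u
  rw [fderiv_eval (a := fun y => K y v) hd (hd.clm_apply (differentiableAt_const v)),
    fderiv_eval_const hd] at h2
  simpa using h2

theorem covDerivEndo_anticomm (u v : E) :
    covDerivEndo g K x u (K x v) = -K x (covDerivEndo g K x u v) := by
  have := h.fderiv_endo_anticomm hx u v
  simp only [covDerivEndo, map_add, map_sub, h.endo_sq x hx]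
  rw [eq_neg_of_add_eq_zero_left this]
  abel

/-- The form ρ is skew and ∇g = 0, so ∇ρ is skew as well. -/
theorem metric_covDerivEndo_skew (u v w : E) :
    g x (covDerivEndo g K x u v) w = -g x (covDerivEndo g K x u w) v := by
  have hd := h.differentiableAt_endo hx
  have hg := h.differentiableAt hx
  have h1 : (fun y => g y (K y v) w) =ᶠ[𝓝 x] fun y => -g y v (K y w) := by
    filter_upwards [h.isOpen.mem_nhds hx] with y hy using h.metric_endo_left hy v w
  have h2 := fderiv_congr h1 u
  have hKv : ∀ v, DifferentiableAt ℝ (fun y => K y v) x := fun v =>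
    hd.clm_apply (differentiableAt_const v)
  simp only [fderiv_fun_neg, neg_apply] at h2
  rw [fderiv_eval₂ hg (hKv v) (differentiableAt_const w),
    fderiv_eval₂ hg (differentiableAt_const v) (hKv w), fderiv_eval_const hd,
    fderiv_eval_const hd, h.fderiv_eq hx, h.fderiv_eq hx] at h2
  have s := h.symm x hx
  have k := h.metric_endo_left hx
  simp only [covDerivEndo, map_add, map_sub, add_apply, sub_apply]
  simp at h2
  linarith [k (christoffel g x u v) w, k v (christoffel g x u w),
    s v (K x (christoffel g x u w)), s (christoffel g x u (K x w)) v, s (fderiv ℝ K x u w) v,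
    s (K x (christoffel g x u w)) v]

/-- Differentiating K X = ε X gives (D_u K) X = (ε - K) D_u X. For two sections X, Y of the
eigendistribution, the difference of these expressions is therefore (ε - K) applied to their bracket
up to sign, and integrability makes that vanish. -/
theorem fderiv_endo_comm_of_integrable {ε : ℝ} (hε : ε * ε = 1)
    (hi : IsIntegrableEigendistribution K V ε) {v w : E} (hv : K x v = ε • v)
    (hw : K x w = ε • w) : fderiv ℝ K x v w = fderiv ℝ K x w v := by
  have hd := h.differentiableAt_endo hx
  -- Projecting a constant vector to the ε-eigenspace gives a smooth section; at x it returns the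
  -- vector itself when that is already an eigenvector.
  let X : E → E → E := fun v y => (1 / 2 : ℝ) • (v + ε • K y v)
  have hX : ∀ v, ContDiffOn ℝ ∞ (X v) V := fun v =>
    contDiffOn_const.smul (contDiffOn_const.add
      (contDiffOn_const.smul (h.smooth_endo.clm_apply contDiffOn_const)))
  have hXK : ∀ v, ∀ y ∈ V, K y (X v y) = ε • X v y := fun v y hy => by
    simp only [X, map_smul, map_add, h.endo_sq y hy, smul_add, smul_smul]
    rw [show ε * (1 / 2 * ε) = (1 / 2 : ℝ) by linarith, add_comm]
    ring_nf
  have hXx : ∀ v, K x v = ε • v → X v x = v := fun v hv => by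
    simp only [X, hv, smul_smul, hε]
    module
  have hXd : ∀ v, DifferentiableAt ℝ (X v) x := fun v =>
    ((hX v).contDiffAt (h.isOpen.mem_nhds hx)).differentiableAt (by simp)
  have key : ∀ v u, fderiv ℝ K x u (X v x) + K x (fderiv ℝ (X v) x u)
      = ε • fderiv ℝ (X v) x u := fun v u => by
    have h1 : (fun y => K y (X v y)) =ᶠ[𝓝 x] fun y => ε • X v y := by
      filter_upwards [h.isOpen.mem_nhds hx] with y hy using hXK v y hy
    have h2 := fderiv_congr h1 u
    rw [fderiv_eval hd (hXd v), fderiv_fun_const_smul (hXd v)] at h2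
    exact h2
  have hb := hi V subset_rfl h.isOpen (X v) (X w) (hX v) (hX w) (hXK v) (hXK w) x hx
  rw [VectorField.lieBracket_eq] at hb
  simp only [hXx v hv, hXx w hw, map_sub, smul_sub] at hb
  have k1 := key w v
  have k2 := key v w
  rw [hXx w hw] at k1
  rw [hXx v hv] at k2
  rw [eq_sub_of_add_eq k1, eq_sub_of_add_eq k2, sub_eq_sub_iff_sub_eq_sub]
  exact hb.symm

theorem covDerivEndo_comm_of_integrable {ε : ℝ} (hε : ε * ε = 1)
    (hi : IsIntegrableEigendistribution K V ε) {v w : E} (hv : K x v = ε • v)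
    (hw : K x w = ε • w) : covDerivEndo g K x v w = covDerivEndo g K x w v := by
  simp only [covDerivEndo, hv, hw, map_smul,
    h.fderiv_endo_comm_of_integrable hx hε hi hv hw, h.christoffel_symm hx v w]

theorem fderiv_paraKahler_apply (u v w : E) :
    fderiv ℝ (fun y => g y (K y v) w) x u = g x (covDerivEndo g K x u v) w
      + g x (K x (christoffel g x u v)) w + g x (K x v) (christoffel g x u w) := by
  have hd := h.differentiableAt_endo hx
  rw [fderiv_eval₂ (h.differentiableAt hx) (hd.clm_apply (differentiableAt_const v))
    (differentiableAt_const w), fderiv_eval_const hd, h.fderiv_eq hx]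
  simp [covDerivEndo]
  ring

/-- For a torsion-free connection dρ is the cyclic sum of ∇ρ. -/
theorem cyclic_covDerivEndo_of_closed (hc : extDeriv (paraKahlerForm g K) x = 0) (u v w : E) :
    g x (covDerivEndo g K x u v) w + g x (covDerivEndo g K x v w) u
      + g x (covDerivEndo g K x w u) v = 0 := by
  have hp : ∀ y ∈ V, ∀ m : Fin 2 → E, paraKahlerForm g K y m = g y (K y (m 0)) (m 1) := by
    intro y hy m
    have := h.metric_endo_left hy (m 1) (m 0)
    rw [h.symm y hy (m 1)] at this
    simp [paraKahlerForm, ContinuousAlternatingMap.alternatizeUncurryFin_apply,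
      Fin.sum_univ_two, Fin.removeNth_apply, this]
    ring
  have hdiff : DifferentiableAt ℝ (paraKahlerForm g K) x := by
    unfold paraKahlerForm
    have h1 : DifferentiableAt ℝ (fun y => (g y).comp (K y)) x :=
      (h.differentiableAt hx).clm_comp (h.differentiableAt_endo hx)
    have h2 : DifferentiableAt ℝ (fun y => ((ContinuousAlternatingMap.ofSubsingletonLIE (𝕜 := ℝ)
        (E := E) (F := ℝ)
        (0 : Fin 1)).toContinuousLinearEquiv.toContinuousLinearMap.comp ((g y).comp (K y)))) x :=
      (differentiableAt_const _).clm_comp h1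
    exact ((ContinuousAlternatingMap.alternatizeUncurryFinCLM ℝ E ℝ).differentiableAt.comp x
      h2).const_smul (1 / 2 : ℝ)
  have e : ∀ (m : Fin 2 → E) (z : E),
      fderiv ℝ (fun y => paraKahlerForm g K y m) x z = g x (covDerivEndo g K x z (m 0)) (m 1)
      + g x (K x (christoffel g x z (m 0))) (m 1) + g x (K x (m 0)) (christoffel g x z (m 1)) := by
    intro m z
    rw [← h.fderiv_paraKahler_apply hx]
    apply fderiv_congr
    filter_upwards [h.isOpen.mem_nhds hx] with y hy using hp y hy m
  have h4 := extDeriv_two_apply hdiff u v w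
  simp only [hc, e] at h4
  simp at h4
  -- The Christoffel terms cancel in pairs by symmetry and by the skewness of K; skewness of ∇ρ then
  -- brings the middle term into cyclic order.
  rw [h.christoffel_symm hx v u, h.christoffel_symm hx w u, h.christoffel_symm hx w v] at h4
  have k := h.metric_endo_left hx (christoffel g x u w) v
  rw [h.symm x hx _ (K x v)] at k
  linarith [h.metric_covDerivEndo_skew hx v u w]

theorem exists_eigen_decomp (v : E) : ∃ p q : E, K x p = p ∧ K x q = -q ∧ v = p + q := by
  refine ⟨(1 / 2 : ℝ) • (v + K x v), (1 / 2 : ℝ) • (v - K x v), ?_, ?_, ?_⟩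
  · rw [map_smul, map_add, h.endo_sq x hx, add_comm]
  · rw [map_smul, map_sub, h.endo_sq x hx]; module
  · module

theorem isotropic {ε : ℝ} (hε : ε * ε = 1) {v w : E} (hv : K x v = ε • v) (hw : K x w = ε • w) :
    g x v w = 0 := by
  have := h.compat x hx v w
  simp only [hv, hw, map_smul, smul_apply, smul_eq_mul] at this
  rw [← mul_assoc, hε] at this
  linarith

/-- The components T(u, v, z) = g((∇_u K)v, z) are killed type by type: anticommutation with K
disposes of v, z of different type, integrability of u, v, z all of the same type, and closedness of
u opposite to v and z. -/
theorem covDerivEndo_eigen_eq_zero {ε : ℝ} (hε : ε * ε = 1)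
    (hi : IsIntegrableEigendistribution K V ε) (hc : extDeriv (paraKahlerForm g K) x = 0)
    (u : E) {v : E} (hv : K x v = ε • v) : covDerivEndo g K x u v = 0 := by
  have hcross : ∀ u v z, K x v = ε • v → K x z = -(ε • z) → g x (covDerivEndo g K x u v) z = 0 := by
    intro u v z hv hz
    refine h.isotropic hx (ε := -ε) (by linarith) ?_ (by rw [hz, neg_smul])
    have := h.covDerivEndo_anticomm hx u v
    rw [hv] at this
    have e : covDerivEndo g K x u (ε • v) = ε • covDerivEndo g K x u v := by
      simp only [covDerivEndo, map_smul, smul_sub, smul_add]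
    rw [neg_smul, ← e, this, neg_neg]
  -- On ε-eigenvectors T is symmetric in its first two arguments and skew in its last two, hence
  -- zero.
  have hsame : ∀ u v z, K x u = ε • u → K x v = ε • v → K x z = ε • z →
      g x (covDerivEndo g K x u v) z = 0 := by
    intro u v z hu hv hz
    have c := fun {a b : E} => h.covDerivEndo_comm_of_integrable hx hε hi (v := a) (w := b)
    have s := h.metric_covDerivEndo_skew hx
    have e1 := s u v z
    have e2 := s z u v
    have e3 := s v z u
    rw [c hu hz] at e1
    rw [c hz hv] at e2
    rw [c hv hu] at e3
    linarith
  have hdecomp : ∀ v, ∃ p q : E, K x p = ε • p ∧ K x q = -(ε • q) ∧ v = p + q := by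
    intro v
    obtain ⟨p, q, hp, hq, rfl⟩ := h.exists_eigen_decomp hx v
    rcases mul_self_eq_one_iff.1 hε with rfl | rfl
    · exact ⟨p, q, by simpa using hp, by simpa using hq, rfl⟩
    · exact ⟨q, p, by simpa using hq, by simpa using hp, add_comm _ _⟩
  have hparallel : ∀ u v, K x u = ε • u → K x v = ε • v → covDerivEndo g K x u v = 0 := by
    intro u v hu hv
    apply (h.nondegenerate x hx).injective
    ext z
    obtain ⟨p, q, hp, hq, rfl⟩ := hdecomp z
    simp [hcross u v q hv hq, hsame u v p hu hv hp]
  apply (h.nondegenerate x hx).injective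
  ext z
  obtain ⟨p, q, hp, hq, rfl⟩ := hdecomp z
  obtain ⟨a, b, ha, hb, rfl⟩ := hdecomp u
  -- The last case has b of the opposite type to v and p. The other two cyclic terms differentiate K
  -- along an ε-eigenvector, so the previous cases make them vanish.
  have h1 := h.cyclic_covDerivEndo_of_closed hx hc b v p
  rw [hparallel v p hv hp, h.metric_covDerivEndo_skew hx p b v, hparallel p v hp hv] at h1
  simp at h1
  simp [covDerivEndo_add_left, hcross _ v q hv hq, hparallel a v ha hv, h1]

/-- A para-Kähler structure is parallel: `∇K = 0`. -/
theorem covDerivEndo_eq_zero (hp : IsIntegrableEigendistribution K V 1)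
    (hn : IsIntegrableEigendistribution K V (-1)) (hc : extDeriv (paraKahlerForm g K) x = 0)
    (u v : E) : covDerivEndo g K x u v = 0 := by
  obtain ⟨p, q, hp', hq', rfl⟩ := h.exists_eigen_decomp hx v
  rw [covDerivEndo_add_right, h.covDerivEndo_eigen_eq_zero hx (by norm_num) hp hc u (by simpa using hp'),
    h.covDerivEndo_eigen_eq_zero hx (by norm_num) hn hc u (by simpa using hq'), add_zero]

end IsParaHermitianOn

/-! ### Structure equations of a moving adapted frame -/

section MovingFrame

variable {U : Type*} [NormedAddCommGroup U] [NormedSpace ℝ U]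

/-- `f` is a smooth adapted frame along the projection `π : O → V`. -/
structure IsMovingFrame (g : E → E →L[ℝ] E →L[ℝ] ℝ) (K : E → E →L[ℝ] E) (V : Set E)
    (π : U →L[ℝ] E) (O : Set U) (f : U → Fin 4 → E) : Prop where
  isOpen : IsOpen O
  mapsTo : ∀ u ∈ O, π u ∈ V
  smooth : ∀ a, ContDiffOn ℝ ∞ (fun u => f u a) O
  adapted : ∀ u ∈ O, IsAdaptedFrame (g (π u)) (K (π u)) (f u)

/-- The covariant differential of the `b`-th vector of a moving frame. -/
noncomputable def covDerivFrame (g : E → E →L[ℝ] E →L[ℝ] ℝ) (π : U →L[ℝ] E) (f : U → Fin 4 → E)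
    (u : U) (b : Fin 4) : U →L[ℝ] E :=
  fderiv ℝ (fun w => f w b) u + ((christoffel g (π u)).flip (f u b)).comp π

/-- The tautological forms of a moving frame. -/
noncomputable def movingCoframe (g : E → E →L[ℝ] E →L[ℝ] ℝ) (π : U →L[ℝ] E) (f : U → Fin 4 → E)
    (u : U) (c : Fin 4) : U →L[ℝ] ℝ :=
  (coframe (g (π u)) (f u) c).comp π

/-- The connection forms of a moving frame. -/
noncomputable def movingConnection (g : E → E →L[ℝ] E →L[ℝ] ℝ) (π : U →L[ℝ] E)
    (f : U → Fin 4 → E) (u : U) (c b : Fin 4) : U →L[ℝ] ℝ :=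
  (coframe (g (π u)) (f u) c).comp (covDerivFrame g π f u b)

theorem covDerivFrame_apply (g : E → E →L[ℝ] E →L[ℝ] ℝ) (π : U →L[ℝ] E) (f : U → Fin 4 → E)
    (u : U) (b : Fin 4) (ξ : U) :
    covDerivFrame g π f u b ξ
      = fderiv ℝ (fun w => f w b) u ξ + christoffel g (π u) (π ξ) (f u b) := rfl

theorem coframe_sum {g : E →L[ℝ] E →L[ℝ] ℝ} {K : E →L[ℝ] E} {e : Fin 4 → E}
    (he : IsAdaptedFrame g K e) (t : Fin 4 → ℝ) (c : Fin 4) :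
    coframe g e c (∑ a, t a • e a) = t c := by
  simp [coframe_apply_frame he]

theorem coframe_endo {g : E →L[ℝ] E →L[ℝ] ℝ} {K : E →L[ℝ] E} {e : Fin 4 → E}
    [FiniteDimensional ℝ E] (hdim : Module.finrank ℝ E = 4)
    (he : IsAdaptedFrame g K e) (c : Fin 4) (v : E) :
    coframe g e c (K v) = paraSign c * coframe g e c v := by
  conv_lhs => rw [he.expand hdim v]
  simp only [map_sum, map_smul, he.eigen, coframe_apply_frame he]
  simp [mul_comm]

namespace IsMovingFrame

variable {g : E → E →L[ℝ] E →L[ℝ] ℝ} {K : E → E →L[ℝ] E} {V : Set E} {π : U →L[ℝ] E} {O : Set U}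
  {f : U → Fin 4 → E} (F : IsMovingFrame g K V π O f) (h : IsParaHermitianOn g K V)
  {u : U} (hu : u ∈ O)

include F hu

theorem contDiffAt (a : Fin 4) : ContDiffAt ℝ ∞ (fun w => f w a) u :=
  (F.smooth a).contDiffAt (F.isOpen.mem_nhds hu)

theorem differentiableAt (a : Fin 4) : DifferentiableAt ℝ (fun w => f w a) u :=
  (F.contDiffAt hu a).differentiableAt (by simp)

include h

theorem contDiffAt_coframe (c : Fin 4) :
    ContDiffAt ℝ ∞ (fun w => coframe (g (π w)) (f w) c) u :=
  ((h.contDiffAt (F.mapsTo u hu)).comp u π.contDiff.contDiffAt).clm_apply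
    (F.contDiffAt hu (c + 2))

theorem contDiffAt_movingCoframe (c : Fin 4) :
    ContDiffAt ℝ ∞ (fun w => movingCoframe g π f w c) u :=
  (F.contDiffAt_coframe h hu c).clm_comp contDiffAt_const

theorem contDiffAt_covDerivFrame [CompleteSpace E] (b : Fin 4) :
    ContDiffAt ℝ ∞ (fun w => covDerivFrame g π f w b) u := by
  have h1 : ContDiffAt ℝ ∞ (fderiv ℝ (fun w => f w b)) u :=
    (F.contDiffAt hu b).fderiv_right (by simp)
  have h2 : ContDiffAt ℝ ∞ (fun w => (christoffel g (π w)).flip) u :=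
    ((ContinuousLinearMap.flipₗᵢ ℝ E E E).contDiff.contDiffAt).comp u
      ((h.contDiffAt_christoffel (F.mapsTo u hu)).comp u π.contDiff.contDiffAt)
  exact h1.add ((h2.clm_apply (F.contDiffAt hu b)).clm_comp contDiffAt_const)

theorem contDiffAt_movingConnection [CompleteSpace E] (c b : Fin 4) :
    ContDiffAt ℝ ∞ (fun w => movingConnection g π f w c b) u :=
  (F.contDiffAt_coframe h hu c).clm_comp (F.contDiffAt_covDerivFrame h hu b)

/-- The Gram matrix of an adapted frame is constant. As g pairs the index a with a + 2 modulo 4,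
shifting by 2 lowers an index. -/
theorem movingConnection_skew (a b : Fin 4) :
    movingConnection g π f u a b = -movingConnection g π f u (b + 2) (a + 2) := by
  have hx := F.mapsTo u hu
  ext ξ
  have h1 : (fun w => g (π w) (f w (a + 2)) (f w b)) =ᶠ[𝓝 u] fun _ => nullGram (a + 2) b := by
    filter_upwards [F.isOpen.mem_nhds hu] with w hw using (F.adapted w hw).gram _ _
  have h2 := fderiv_congr h1 ξ
  have hg : DifferentiableAt ℝ (fun w => g (π w)) u :=
    (h.differentiableAt hx).comp u π.differentiableAt
  have hgπ : fderiv ℝ (fun w => g (π w)) u ξ = fderiv ℝ g (π u) (π ξ) := by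
    have := ((h.differentiableAt hx).hasFDerivAt.comp u π.hasFDerivAt).fderiv
    exact congrArg (fun T : U →L[ℝ] _ => T ξ) this
  rw [fderiv_eval₂ hg (F.differentiableAt hu _) (F.differentiableAt hu _), hgπ,
    h.fderiv_eq hx] at h2
  have e : b + 2 + 2 = b := by fin_cases b <;> rfl
  simp only [movingConnection, coframe, ContinuousLinearMap.comp_apply, covDerivFrame_apply,
    map_add, neg_apply, e]
  simp at h2
  rw [h.symm _ hx (f u b), h.symm _ hx (f u b)]
  linarith

variable [FiniteDimensional ℝ E] (hdim : Module.finrank ℝ E = 4)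

omit h in
include hdim in
theorem sum_movingCoframe (ξ : U) : ∑ a, movingCoframe g π f u a ξ • f u a = π ξ :=
  ((F.adapted u hu).expand hdim (π ξ)).symm

omit h in
include hdim in
theorem sum_movingConnection (b : Fin 4) (ξ : U) :
    ∑ a, movingConnection g π f u a b ξ • f u a = covDerivFrame g π f u b ξ :=
  ((F.adapted u hu).expand hdim _).symm

omit h in
include hdim in
theorem fderiv_frame (b : Fin 4) (ξ : U) :
    fderiv ℝ (fun w => f w b) u ξ = ∑ a, movingConnection g π f u a b ξ • f u a
      - christoffel g (π u) (π ξ) (f u b) := by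
  rw [F.sum_movingConnection hu hdim, covDerivFrame_apply, add_sub_cancel_right]

omit h in
include hdim in
/-- The derivative of a moving linear combination of the frame vectors. -/
theorem fderiv_sum_smul {t : Fin 4 → U → ℝ} (ht : ∀ a, DifferentiableAt ℝ (t a) u) (ξ : U) :
    fderiv ℝ (fun w => ∑ a, t a w • f w a) u ξ
      = ∑ c, (fderiv ℝ (t c) u ξ + ∑ a, movingConnection g π f u c a ξ * t a u) • f u c
        - christoffel g (π u) (π ξ) (∑ a, t a u • f u a) := by
  rw [fderiv_fun_sum (fun a _ => (ht a).fun_smul (F.differentiableAt hu a))]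
  simp only [sum_apply]
  have e : ∀ a, fderiv ℝ (fun w => t a w • f w a) u ξ = fderiv ℝ (t a) u ξ • f u a +
      t a u • (∑ c, movingConnection g π f u c a ξ • f u c
      - christoffel g (π u) (π ξ) (f u a)) := fun a => by
    rw [fderiv_fun_smul (ht a) (F.differentiableAt hu a), ← F.fderiv_frame hu hdim]
    simp [add_comm]
  simp only [e, map_sum, map_smul, add_smul, Finset.sum_add_distrib, smul_sub,
    Finset.sum_sub_distrib, Finset.sum_smul, Finset.smul_sum, smul_smul]
  rw [Finset.sum_comm, add_sub_assoc]
  simp only [mul_comm]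

include hdim in
-- Obtained by differentiating ∑ θᵃ(η) fₐ = π η, whose right side is constant, and reading off the
-- c-th component. The Christoffel term is symmetric in ξ, η and disappears from dθ.
theorem fderiv_movingCoframe (c : Fin 4) (ξ η : U) :
    fderiv ℝ (fun w => movingCoframe g π f w c) u ξ η
      = -∑ a, movingConnection g π f u c a ξ * movingCoframe g π f u a η
        + coframe (g (π u)) (f u) c (christoffel g (π u) (π ξ) (π η)) := by
  have hd : ∀ a, DifferentiableAt ℝ (fun w => movingCoframe g π f w a) u := fun a =>
    (F.contDiffAt_movingCoframe h hu a).differentiableAt (by simp)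
  have h1 : (fun w => ∑ a, movingCoframe g π f w a η • f w a) =ᶠ[𝓝 u] fun _ => π η := by
    filter_upwards [F.isOpen.mem_nhds hu] with w hw using F.sum_movingCoframe hw hdim η
  have h2 := fderiv_congr h1 ξ
  rw [F.fderiv_sum_smul hu hdim (fun a => (hd a).clm_apply (differentiableAt_const η)),
    F.sum_movingCoframe hu hdim] at h2
  have h3 := congrArg (coframe (g (π u)) (f u) c) h2
  rw [map_sub, coframe_sum (F.adapted u hu), fderiv_eval_const (hd c)] at h3
  simp at h3
  linarith

include hdim in
/-- The first structure equation `dθ = -Γ ∧ θ`. -/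
theorem first_structure (c : Fin 4) (m : Fin 2 → U) :
    extDeriv (fun w => oneForm (movingCoframe g π f w c)) u m
      = -∑ a, wedge₁ (movingConnection g π f u c a) (movingCoframe g π f u a) m := by
  rw [extDeriv_oneForm_apply ((F.contDiffAt_movingCoframe h hu c).differentiableAt (by simp)),
    F.fderiv_movingCoframe h hu hdim, F.fderiv_movingCoframe h hu hdim,
    h.christoffel_symm (F.mapsTo u hu) (π (m 1))]
  simp only [wedge₁_apply, Finset.sum_sub_distrib]
  ring

include hdim in
-- Obtained by differentiating ∑ Γᵃ_b(η) fₐ = ∇_η f_b. After antisymmetrization in ξ, η the second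
-- derivative of the frame drops out, as do the two terms mixing a Christoffel symbol with a first
-- derivative; the rest is the Riemann tensor.
theorem fderiv_movingConnection (c b : Fin 4) (ξ η : U) :
    fderiv ℝ (fun w => movingConnection g π f w c b) u ξ η
      = -∑ a, movingConnection g π f u c a ξ * movingConnection g π f u a b η
        + coframe (g (π u)) (f u) c (fderiv ℝ (fderiv ℝ fun w => f w b) u ξ η
          + fderiv ℝ (christoffel g) (π u) (π ξ) (π η) (f u b)
          + christoffel g (π u) (π η) (fderiv ℝ (fun w => f w b) u ξ)
          + christoffel g (π u) (π ξ) (fderiv ℝ (fun w => f w b) u η)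
          + christoffel g (π u) (π ξ) (christoffel g (π u) (π η) (f u b))) := by
  have : CompleteSpace E := FiniteDimensional.complete ℝ E
  have hx := F.mapsTo u hu
  have hd : ∀ a, DifferentiableAt ℝ (fun w => movingConnection g π f w a b) u := fun a =>
    (F.contDiffAt_movingConnection h hu a b).differentiableAt (by simp)
  have hΓ : DifferentiableAt ℝ (christoffel g) (π u) :=
    (h.contDiffAt_christoffel hx).differentiableAt (by simp)
  have hΓ' : DifferentiableAt ℝ (fun w => christoffel g (π w)) u := hΓ.comp u π.differentiableAt
  have hΓπ : fderiv ℝ (fun w => christoffel g (π w)) u ξ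
      = fderiv ℝ (christoffel g) (π u) (π ξ) := by
    exact congrArg (fun T : U →L[ℝ] _ => T ξ) (hΓ.hasFDerivAt.comp u π.hasFDerivAt).fderiv
  have h1 : (fun w => ∑ a, movingConnection g π f w a b η • f w a) =ᶠ[𝓝 u]
      fun w => fderiv ℝ (fun w => f w b) w η + christoffel g (π w) (π η) (f w b) := by
    filter_upwards [F.isOpen.mem_nhds hu] with w hw using F.sum_movingConnection hw hdim b η
  have h2 := fderiv_congr h1 ξ
  have hf' : DifferentiableAt ℝ (fderiv ℝ (fun w => f w b)) u :=
    ((F.contDiffAt hu b).fderiv_right (m := ∞) (by simp)).differentiableAt (by simp)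
  rw [F.fderiv_sum_smul hu hdim (fun a => (hd a).clm_apply (differentiableAt_const η)),
    F.sum_movingConnection hu hdim, fderiv_fun_add (hf'.clm_apply (differentiableAt_const η))
      ((hΓ'.clm_apply (differentiableAt_const _)).clm_apply (F.differentiableAt hu b)),
    add_apply, fderiv_eval_const hf',
    fderiv_eval₂ hΓ' (differentiableAt_const _) (F.differentiableAt hu b), hΓπ] at h2
  have h3 := congrArg (coframe (g (π u)) (f u) c) (eq_add_of_sub_eq h2)
  rw [coframe_sum (F.adapted u hu), fderiv_eval_const (hd c)] at h3
  rw [eq_neg_add_iff_add_eq, add_comm, h3]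
  congr 1
  simp [covDerivFrame_apply]
  abel

include hdim in
/-- The second structure equation `dΓ + Γ ∧ Γ = R`. -/
theorem second_structure (c b : Fin 4) (m : Fin 2 → U) :
    extDeriv (fun w => oneForm (movingConnection g π f w c b)) u m
      + ∑ a, wedge₁ (movingConnection g π f u c a) (movingConnection g π f u a b) m
      = coframe (g (π u)) (f u) c (riemann g (π u) (π (m 0)) (π (m 1)) (f u b)) := by
  have : CompleteSpace E := FiniteDimensional.complete ℝ E
  rw [extDeriv_oneForm_apply ((F.contDiffAt_movingConnection h hu c b).differentiableAt (by simp)),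
    F.fderiv_movingConnection h hu hdim, F.fderiv_movingConnection h hu hdim]
  have hs : fderiv ℝ (fderiv ℝ fun w => f w b) u (m 1) (m 0) =
      fderiv ℝ (fderiv ℝ fun w => f w b) u (m 0) (m 1) :=
    ((F.contDiffAt hu b).isSymmSndFDerivAt (by simpa using ENat.LEInfty.out)).eq _ _
  simp only [wedge₁_apply, Finset.sum_sub_distrib, riemann, map_add, map_sub, hs]
  ring

variable (hpar : ∀ x ∈ V, ∀ u v, covDerivEndo g K x u v = 0)

include hdim hpar in
-- As ∇K = 0, the covariant derivative of an eigenvector field of K is an eigenvector with the same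
-- eigenvalue.
theorem movingConnection_mixed {a b : Fin 4} (hab : paraSign a ≠ paraSign b) :
    movingConnection g π f u a b = 0 := by
  have hx := F.mapsTo u hu
  have hd := h.differentiableAt_endo hx
  ext ξ
  have h1 : (fun w => K (π w) (f w b)) =ᶠ[𝓝 u] fun w => paraSign b • f w b := by
    filter_upwards [F.isOpen.mem_nhds hu] with w hw using (F.adapted w hw).eigen b
  have h2 := fderiv_congr h1 ξ
  have hK : fderiv ℝ (fun w => K (π w)) u ξ = fderiv ℝ K (π u) (π ξ) := by
    exact congrArg (fun T : U →L[ℝ] _ => T ξ) (hd.hasFDerivAt.comp u π.hasFDerivAt).fderiv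
  rw [fderiv_eval (T := fun w => K (π w)) (hd.comp u π.differentiableAt) (F.differentiableAt hu b),
    fderiv_fun_const_smul (F.differentiableAt hu b), hK, smul_apply] at h2
  have h3 := hpar _ hx (π ξ) (f u b)
  rw [covDerivEndo, (F.adapted u hu).eigen, map_smul] at h3
  have h4 : K (π u) (covDerivFrame g π f u b ξ) = paraSign b • covDerivFrame g π f u b ξ := by
    rw [covDerivFrame_apply, map_add, smul_add, ← h2, ← sub_eq_zero, ← neg_eq_zero, ← h3]
    abel
  have h5 := congrArg (coframe (g (π u)) (f u) a) h4
  rw [coframe_endo hdim (F.adapted u hu), map_smul, smul_eq_mul] at h5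
  exact (mul_eq_mul_right_iff.1 h5).resolve_left hab

end IsMovingFrame

end MovingFrame

/-! ### The Bianchi identity of a matrix-valued form -/

section Bianchi

theorem ContDiffAt.oneForm {U : Type*} [NormedAddCommGroup U] [NormedSpace ℝ U]
    {α : U → E →L[ℝ] ℝ} {x : U} {n : WithTop ℕ∞} (hα : ContDiffAt ℝ n α x) :
    ContDiffAt ℝ n (fun y => ParaKahler.oneForm (α y)) x :=
  (ContinuousAlternatingMap.ofSubsingletonLIE (𝕜 := ℝ) (E := E) (F := ℝ)
        (0 : Fin 1)).contDiff.contDiffAt.comp x hα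

theorem ContDiffAt.wedge₁ {U : Type*} [NormedAddCommGroup U] [NormedSpace ℝ U]
    {α β : U → E →L[ℝ] ℝ} {x : U} {n : WithTop ℕ∞} (hα : ContDiffAt ℝ n α x)
    (hβ : ContDiffAt ℝ n β x) :
    ContDiffAt ℝ n (fun y => ParaKahler.wedge₁ (α y) (β y)) x :=
  (ContinuousAlternatingMap.alternatizeUncurryFinCLM ℝ E ℝ).contDiff.contDiffAt.comp x
    (hα.smulRight (ContDiffAt.oneForm hβ))

/-- The rule d(α∧β) = dα∧β - α∧dβ, with dα∧β written as β∧dα because `wedge` takes its 1-covector on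
the left. -/
theorem extDeriv_wedge₁ {α β : E → E →L[ℝ] ℝ} {x : E} (hα : ContDiffAt ℝ 1 α x)
    (hβ : ContDiffAt ℝ 1 β x) (u v w : E) :
    extDeriv (fun y => wedge₁ (α y) (β y)) x ![u, v, w] =
      wedge (β x) (extDeriv (fun y => oneForm (α y)) x) ![u, v, w]
        - wedge (α x) (extDeriv (fun y => oneForm (β y)) x) ![u, v, w] := by
  have ha := hα.differentiableAt (by simp)
  have hb := hβ.differentiableAt (by simp)
  have e : ∀ a b z : E, fderiv ℝ (fun y => α y a * β y b - α y b * β y a) x z =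
      fderiv ℝ α x z a * β x b + α x a * fderiv ℝ β x z b
      - (fderiv ℝ α x z b * β x a + α x b * fderiv ℝ β x z a) := fun a b z => by
    have ha' : ∀ a, DifferentiableAt ℝ (fun y => α y a) x := fun a => by fun_prop
    have hb' : ∀ a, DifferentiableAt ℝ (fun y => β y a) x := fun a => by fun_prop
    rw [fderiv_fun_sub ((ha' a).fun_mul (hb' b)) ((ha' b).fun_mul (hb' a)),
      fderiv_fun_mul (ha' a) (hb' b), fderiv_fun_mul (ha' b) (hb' a)]
    simp only [sub_apply, add_apply, smul_apply, fderiv_eval_const ha, fderiv_eval_const hb,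
      smul_eq_mul]
    ring
  rw [extDeriv_two_apply ((ContDiffAt.wedge₁ hα hβ).differentiableAt (by simp))]
  simp only [wedge_two, extDeriv_oneForm_apply ha, extDeriv_oneForm_apply hb, wedge₁_apply]
  simp [e]
  ring

theorem wedge_add {n : ℕ} (α : E →L[ℝ] ℝ) (η ζ : E [⋀^Fin n]→L[ℝ] ℝ) :
    wedge α (η + ζ) = wedge α η + wedge α ζ := by
  ext v
  simp [wedge, ContinuousAlternatingMap.alternatizeUncurryFin_apply,
    Finset.sum_add_distrib]

theorem wedge_smul {n : ℕ} (α : E →L[ℝ] ℝ) (c : ℝ) (η : E [⋀^Fin n]→L[ℝ] ℝ) :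
    wedge α (c • η) = c • wedge α η := by
  ext v
  simp [wedge, ContinuousAlternatingMap.alternatizeUncurryFin_apply, Finset.mul_sum,
    mul_left_comm]

theorem wedge_neg {n : ℕ} (α : E →L[ℝ] ℝ) (η : E [⋀^Fin n]→L[ℝ] ℝ) :
    wedge α (-η) = -wedge α η := by
  simpa using wedge_smul α (-1) η

/-- A cyclic permutation of three factors is even. -/
theorem wedge_wedge₁_rotate (α β γ : E →L[ℝ] ℝ) :
    wedge α (wedge₁ β γ) = wedge γ (wedge₁ α β) := by
  ext v
  simp only [wedge_two, wedge₁_apply]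
  simp
  ring

theorem wedge_sum {n : ℕ} {ι : Type*} (s : Finset ι) (α : E →L[ℝ] ℝ)
    (η : ι → E [⋀^Fin n]→L[ℝ] ℝ) :
    wedge α (∑ k ∈ s, η k) = ∑ k ∈ s, wedge α (η k) :=
  map_sum (AddMonoidHom.mk' (wedge α) (wedge_add α)) η s

theorem extDeriv_wedge₁_eq {α β : E → E →L[ℝ] ℝ} {x : E} (hα : ContDiffAt ℝ 1 α x)
    (hβ : ContDiffAt ℝ 1 β x) :
    extDeriv (fun y => wedge₁ (α y) (β y)) x =
      wedge (β x) (extDeriv (fun y => oneForm (α y)) x)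
        - wedge (α x) (extDeriv (fun y => oneForm (β y)) x) := by
  ext m
  have hm : m = ![m 0, m 1, m 2] := by ext i; fin_cases i <;> rfl
  rw [hm]
  exact extDeriv_wedge₁ hα hβ _ _ _

theorem contDiffAt_extDeriv_oneForm {α : E → E →L[ℝ] ℝ} {x : E} (hα : ContDiffAt ℝ ∞ α x) :
    ContDiffAt ℝ ∞ (extDeriv fun y => oneForm (α y)) x :=
  (ContinuousAlternatingMap.alternatizeUncurryFinCLM ℝ E ℝ).contDiff.contDiffAt.comp x
    ((ContDiffAt.oneForm hα).fderiv_right (m := ∞) (by simp))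

/-- The Bianchi identity `DK = 0` for the curvature `K` of a matrix-valued `1`-form. -/
theorem covExtDeriv_curvatureForm {A : E → MatCovector₁ E} {x : E}
    (hA : ∀ i j, ContDiffAt ℝ ∞ (fun y => A y i j) x) :
    covExtDeriv A (curvatureForm A) x = 0 := by
  have hA1 : ∀ i j, ContDiffAt ℝ 1 (fun y => A y i j) x := fun i j =>
    (hA i j).of_le (one_le_two.trans ENat.LEInfty.out)
  have hw : ∀ i j k, DifferentiableAt ℝ (fun y => wedge₁ (A y i k) (A y k j)) x := fun i j k =>
    (ContDiffAt.wedge₁ (hA1 i k) (hA1 k j)).differentiableAt (by simp)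
  ext1 i j
  have hd : extDeriv (fun y => curvatureForm A y i j) x = ∑ k,
      (wedge (A x k j) (extDeriv (fun y => oneForm (A y i k)) x)
        - wedge (A x i k) (extDeriv (fun y => oneForm (A y k j)) x)) := by
    have hdd : extDeriv (extDeriv fun y => oneForm (A y i j)) x = 0 :=
      extDeriv_extDeriv_apply (ContDiffAt.oneForm (hA i j)) (by simpa using ENat.LEInfty.out)
    have h1 := (contDiffAt_extDeriv_oneForm (hA i j)).differentiableAt (by simp)
    simp only [curvatureForm, Matrix.of_apply, Fin.sum_univ_three]
    rw [extDeriv_fun_add h1 (((hw i j 0).fun_add (hw i j 1)).fun_add (hw i j 2)),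
      extDeriv_fun_add ((hw i j 0).fun_add (hw i j 1)) (hw i j 2),
      extDeriv_fun_add (hw i j 0) (hw i j 1), hdd, zero_add,
      extDeriv_wedge₁_eq (hA1 i 0) (hA1 0 j), extDeriv_wedge₁_eq (hA1 i 1) (hA1 1 j),
      extDeriv_wedge₁_eq (hA1 i 2) (hA1 2 j)]
  simp only [covExtDeriv, Matrix.of_apply, hd, Matrix.zero_apply]
  simp only [curvatureForm, Matrix.of_apply, wedge_add, wedge_sum, Finset.sum_add_distrib,
    Finset.sum_sub_distrib]
  -- The cubic terms of 𝒜∧(𝒜∧𝒜) and (𝒜∧𝒜)∧𝒜 agree; the terms in d𝒜 cancel against d(𝒜∧𝒜).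
  have hc : ∑ k, ∑ l, wedge (A x i k) (wedge₁ (A x k l) (A x l j))
      = ∑ k, ∑ l, wedge (A x k j) (wedge₁ (A x i l) (A x l k)) := by
    rw [Finset.sum_comm]
    exact Finset.sum_congr rfl fun k _ => Finset.sum_congr rfl fun l _ =>
      wedge_wedge₁_rotate _ _ _
  rw [hc]
  abel

end Bianchi

/-! ### Algebraic curvature tensors of para-Kähler-Einstein type -/

/-- Replaces the comparison of real eigenvalues by a decidable condition on indices. -/
theorem paraSign_eq_iff (a b : Fin 4) : paraSign a = paraSign b ↔ (a < 2 ↔ b < 2) := by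
  have h0 : paraSign 0 = 1 := rfl
  have h1 : paraSign 1 = 1 := rfl
  have h2 : paraSign 2 = -1 := rfl
  have h3 : paraSign 3 = -1 := rfl
  fin_cases a <;> fin_cases b <;> simp [h0, h1, h2, h3] <;> norm_num

/-- The components `r a b c d = Rᵃ_{bcd}` in an adapted frame of a curvature tensor of
para-Kähler-Einstein type with Einstein constant `Λ`. -/
structure IsParaKahlerEinsteinCurvature (r : Fin 4 → Fin 4 → Fin 4 → Fin 4 → ℝ) (Λ : ℝ) :
    Prop where
  antisymm : ∀ a b c d, r a b c d = -r a b d c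
  skew : ∀ a b c d, r a b c d = -r (b + 2) (a + 2) c d
  mixed : ∀ a b c d, paraSign a ≠ paraSign b → r a b c d = 0
  bianchi : ∀ a b c d, r a b c d + r a c d b + r a d b c = 0
  einstein : ∀ b d, ∑ c, r c b c d = Λ * nullGram b d

namespace IsParaKahlerEinsteinCurvature

variable {r : Fin 4 → Fin 4 → Fin 4 → Fin 4 → ℝ} {Λ : ℝ}
  (hr : IsParaKahlerEinsteinCurvature r Λ)

include hr

/-- With the first index lowered, `r (a + 2) b c d` is R_{abcd}. The claim is the classical
combination of four first Bianchi identities with the two antisymmetries. -/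
theorem pair_symm (a b c d : Fin 4) : r (a + 2) b c d = r (c + 2) d a b := by
  have e : ∀ a : Fin 4, a + 2 + 2 = a := by decide
  have s : ∀ a b c d, r (a + 2) b c d = -r (b + 2) a c d := fun a b c d => by
    rw [hr.skew, e]
  have t := hr.antisymm
  have b1 := hr.bianchi (a + 2) b c d
  have b2 := hr.bianchi (b + 2) c d a
  have b3 := hr.bianchi (c + 2) d a b
  have b4 := hr.bianchi (d + 2) a b c
  linarith [s b a c d, s c a d b, s d a b c, s c b d a, s d b a c, s d c a b,
    t (a + 2) c d b, t (a + 2) d b c, t (b + 2) a c d, t (b + 2) d a c, t (b + 2) c d a,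
    t (c + 2) a d b, t (c + 2) b d a, t (c + 2) a b d, t (d + 2) a b c, t (d + 2) b a c,
    t (d + 2) c a b, t (c + 2) b a d]

/-- Pair symmetry moves the form indices c, d to the endomorphism indices c + 2, d, which are of
different type. So the curvature forms have type (1,1). -/
theorem eq_zero_of_same_type (a b : Fin 4) {c d : Fin 4} (h : paraSign c = paraSign d) :
    r a b c d = 0 := by
  have e : ∀ a : Fin 4, a + 2 + 2 = a := by decide
  rw [← e a, hr.pair_symm]
  refine hr.mixed _ _ _ _ ?_
  rw [← h, ne_eq, paraSign_eq_iff]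
  exact (by decide : ∀ c : Fin 4, ¬(c + 2 < 2 ↔ c < 2)) c

/-- The first Bianchi identity turns the Ricci contraction into the trace over the endomorphism
indices, since its third term has form indices of equal type. -/
theorem trace_zero_two : r 0 0 0 2 + r 1 1 0 2 = Λ := by
  have h1 := hr.einstein 0 2
  have h2 := hr.bianchi 1 0 1 2
  simp [Fin.sum_univ_four, nullGram] at h1
  linarith [hr.mixed 2 0 2 2 (by simp [paraSign_eq_iff]), hr.mixed 3 0 3 2 (by simp [paraSign_eq_iff]),
    hr.eq_zero_of_same_type 1 2 (c := 0) (d := 1) rfl, hr.antisymm 1 1 2 0]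

theorem trace_one_three : r 0 0 1 3 + r 1 1 1 3 = Λ := by
  have h1 := hr.einstein 1 3
  have h2 := hr.bianchi 0 1 0 3
  simp [Fin.sum_univ_four, nullGram] at h1
  linarith [hr.mixed 2 1 2 3 (by simp [paraSign_eq_iff]), hr.mixed 3 1 3 3 (by simp [paraSign_eq_iff]),
    hr.eq_zero_of_same_type 0 3 (c := 1) (d := 0) rfl, hr.antisymm 0 0 3 1]

/-- This and the next three lemmas compute the ω-trace of Ω, which is Λ times the identity. Pair
symmetry exchanges a trace over form indices with one over endomorphism indices. -/
theorem ricci_form_zero : r 0 0 0 2 + r 0 0 1 3 = Λ := by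
  rw [show r 0 0 1 3 = r 1 1 0 2 by
    have h1 := hr.pair_symm 2 0 1 3
    have h2 := hr.skew 3 3 2 0
    have h3 := hr.antisymm 1 1 2 0
    simp only [Fin.reduceAdd] at h1 h2
    linarith]
  exact hr.trace_zero_two

theorem ricci_form_one : r 1 1 0 2 + r 1 1 1 3 = Λ := by
  have h1 := hr.pair_symm 2 0 1 3
  have h2 := hr.skew 3 3 2 0
  have h3 := hr.antisymm 1 1 2 0
  simp only [Fin.reduceAdd] at h1 h2
  linarith [hr.trace_one_three]

theorem ricci_form_zero_one : r 0 1 0 2 + r 0 1 1 3 = 0 := by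
  have h1 := hr.einstein 1 2
  have h2 := hr.pair_symm 2 1 1 3
  have h3 := hr.skew 3 3 2 1
  have h4 := hr.bianchi 1 1 1 2
  simp [Fin.sum_univ_four, nullGram] at h1
  simp only [Fin.reduceAdd] at h2 h3
  linarith [hr.mixed 2 1 2 2 (by simp [paraSign_eq_iff]), hr.mixed 3 1 3 2 (by simp [paraSign_eq_iff]),
    hr.antisymm 1 1 2 1]

theorem ricci_form_one_zero : r 1 0 0 2 + r 1 0 1 3 = 0 := by
  have h1 := hr.einstein 0 3
  have h2 := hr.pair_symm 3 0 0 2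
  have h3 := hr.skew 2 2 3 0
  simp [Fin.sum_univ_four, nullGram] at h1
  simp only [Fin.reduceAdd] at h2 h3
  linarith [hr.mixed 2 0 2 3 (by simp [paraSign_eq_iff]), hr.mixed 3 0 3 3 (by simp [paraSign_eq_iff]),
    hr.antisymm 0 0 3 0]

end IsParaKahlerEinsteinCurvature

/-! ### The curvature of a para-Kähler-Einstein structure in a moving frame -/

theorem trace_eq_sum_coframe [FiniteDimensional ℝ E] (hdim : Module.finrank ℝ E = 4)
    {g : E →L[ℝ] E →L[ℝ] ℝ} {K : E →L[ℝ] E} {e : Fin 4 → E} (he : IsAdaptedFrame g K e)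
    (T : E →ₗ[ℝ] E) : LinearMap.trace ℝ E T = ∑ c, coframe g e c (T (e c)) := by
  have h : T = ∑ c, (coframe g e c : E →ₗ[ℝ] ℝ).smulRight (T (e c)) := by
    ext v
    conv_lhs => rw [he.expand hdim v]
    simp
  conv_lhs => rw [h]
  simp [LinearMap.trace_smulRight]

theorem ricci_eq_sum_coframe [FiniteDimensional ℝ E] (hdim : Module.finrank ℝ E = 4)
    {g : E → E →L[ℝ] E →L[ℝ] ℝ} {K : E → E →L[ℝ] E} {x : E} {e : Fin 4 → E}
    (he : IsAdaptedFrame (g x) (K x) e) (v w : E) :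
    ricci g x v w = ∑ c, coframe (g x) e c (riemann g x (e c) w v) := by
  rw [ricci, trace_eq_sum_coframe hdim he]
  rfl

namespace IsMovingFrame

variable {U : Type*} [NormedAddCommGroup U] [NormedSpace ℝ U]
variable {g : E → E →L[ℝ] E →L[ℝ] ℝ} {K : E → E →L[ℝ] E} {V : Set E} {π : U →L[ℝ] E} {O : Set U}
  {f : U → Fin 4 → E} (F : IsMovingFrame g K V π O f) (h : IsParaHermitianOn g K V)
  {u : U} (hu : u ∈ O) [FiniteDimensional ℝ E] (hdim : Module.finrank ℝ E = 4)
  (hpar : ∀ x ∈ V, ∀ u v, covDerivEndo g K x u v = 0) (hπ : Function.Surjective π)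

include F h hu hdim hπ

/-- The second structure equation transfers the skewness of Γ to its curvature; surjectivity of π
makes all pairs X, Y available. -/
theorem riemann_skew (a b : Fin 4) (X Y : E) :
    coframe (g (π u)) (f u) a (riemann g (π u) X Y (f u b))
      = -coframe (g (π u)) (f u) (b + 2) (riemann g (π u) X Y (f u (a + 2))) := by
  have : CompleteSpace E := FiniteDimensional.complete ℝ E
  obtain ⟨ξ, rfl⟩ := hπ X
  obtain ⟨η, rfl⟩ := hπ Y
  have s1 := F.second_structure h hu hdim a b ![ξ, η]
  have s2 := F.second_structure h hu hdim (b + 2) (a + 2) ![ξ, η]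
  have hd : ∀ a b, DifferentiableAt ℝ (fun w => movingConnection g π f w a b) u := fun a b =>
    (F.contDiffAt_movingConnection h hu a b).differentiableAt (by simp)
  have hs : (fun w => movingConnection g π f w a b) =ᶠ[𝓝 u]
      fun w => -movingConnection g π f w (b + 2) (a + 2) := by
    filter_upwards [F.isOpen.mem_nhds hu] with w hw using F.movingConnection_skew h hw a b
  rw [extDeriv_oneForm_apply (hd _ _), hs.fderiv_eq, fderiv_fun_neg] at s1
  rw [extDeriv_oneForm_apply (hd _ _)] at s2
  have e : ∀ a : Fin 4, a + 2 + 2 = a := by decide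
  have hsum : ∑ c, wedge₁ (movingConnection g π f u a c) (movingConnection g π f u c b) ![ξ, η]
      = -∑ c, wedge₁ (movingConnection g π f u (b + 2) c)
        (movingConnection g π f u c (a + 2)) ![ξ, η] := by
    -- After the shift c ↦ c + 2, skewness of Γ exchanges the two factors of each summand, and the
    -- wedge product changes sign.
    rw [← Equiv.sum_comp (Equiv.addRight (2 : Fin 4)), ← Finset.sum_neg_distrib]
    refine Finset.sum_congr rfl fun c _ => ?_
    rw [F.movingConnection_skew h hu a, F.movingConnection_skew h hu _ b]
    simp [wedge₁_apply, e]
    ring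
  rw [hsum] at s1
  simp only [Matrix.cons_val_zero, Matrix.cons_val_one, neg_apply] at s1 s2
  linarith

include hpar in
theorem riemann_mixed {a b : Fin 4} (hab : paraSign a ≠ paraSign b) (X Y : E) :
    coframe (g (π u)) (f u) a (riemann g (π u) X Y (f u b)) = 0 := by
  obtain ⟨ξ, rfl⟩ := hπ X
  obtain ⟨η, rfl⟩ := hπ Y
  have s1 := F.second_structure h hu hdim a b ![ξ, η]
  have hz : (fun w => oneForm (movingConnection g π f w a b)) =ᶠ[𝓝 u] fun _ => oneForm 0 := by
    filter_upwards [F.isOpen.mem_nhds hu] with w hw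
    rw [F.movingConnection_mixed h hw hdim hpar hab]
  have hsum : ∀ c, wedge₁ (movingConnection g π f u a c) (movingConnection g π f u c b) ![ξ, η]
      = 0 := fun c => by
    by_cases hac : paraSign a = paraSign c
    · rw [F.movingConnection_mixed h hu hdim hpar (a := c) (hac ▸ hab)]
      simp [wedge₁_apply]
    · rw [F.movingConnection_mixed h hu hdim hpar hac]
      simp [wedge₁_apply]
  rw [hz.extDeriv_eq, extDeriv_oneForm_apply (differentiableAt_const _)] at s1
  simpa [hsum] using s1.symm

include hpar in
theorem isParaKahlerEinsteinCurvature {Λ : ℝ}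
    (hE : ∀ v w, ricci g (π u) v w = Λ * g (π u) v w) :
    IsParaKahlerEinsteinCurvature (fun a b c d =>
      coframe (g (π u)) (f u) a (riemann g (π u) (f u c) (f u d) (f u b))) Λ where
  antisymm a b c d := by rw [riemann_antisymm, map_neg]
  skew a b c d := F.riemann_skew h hu hdim hπ a b _ _
  mixed a b c d hab := F.riemann_mixed h hu hdim hpar hπ hab _ _
  bianchi a b c d := by
    have : CompleteSpace E := FiniteDimensional.complete ℝ E
    rw [← map_add, ← map_add, add_assoc, add_comm]
    have := h.riemann_bianchi (F.mapsTo u hu) (f u c) (f u d) (f u b)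
    rw [← map_zero (coframe (g (π u)) (f u) a), ← this]
    congr 1
    abel
  einstein b d := by
    rw [← (F.adapted u hu).gram, ← hE, ricci_eq_sum_coframe hdim (F.adapted u hu)]

include hpar in
theorem psiTwoPrime_eq (hE : ∀ v w, ricci g (π u) v w
      = scalarCurvature g (π u) / 4 * g (π u) v w) :
    psiTwoPrime g (π u) (f u) = -(scalarCurvature g (π u) / 4 / 3) := by
  have hA := F.adapted u hu
  -- The Riemann part of C₁₂₃₄ is a mixed component, as g(e₁, ·) = θ³ while e₂ has the opposite
  -- type. Only the Schouten terms contribute, with P = (R/24) g.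
  have hm := F.riemann_mixed h hu hdim hpar hπ (a := 2) (b := 1) (by simp [paraSign_eq_iff])
    (f u 2) (f u 3)
  have hm' : g (π u) (f u 0) (riemann g (π u) (f u 2) (f u 3) (f u 1)) = 0 := hm
  simp [psiTwoPrime, weyl, schouten, hE, hm', hA.gram, nullGram]
  ring

end IsMovingFrame

/-! ### The Cartan connection on the adapted frame bundle -/

/-- `(g, K)` is a para-Kähler-Einstein structure on the open set `V`, para-Kähler meaning that `K`
is parallel. -/
structure IsParaKahlerEinsteinOn [FiniteDimensional ℝ E] (g : E → E →L[ℝ] E →L[ℝ] ℝ)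
    (K : E → E →L[ℝ] E) (V : Set E) : Prop extends IsParaHermitianOn g K V where
  parallel : ∀ x ∈ V, ∀ u v, covDerivEndo g K x u v = 0
  einstein : ∀ x ∈ V, ∀ v w, ricci g x v w = scalarCurvature g x / 4 * g x v w

theorem projBase_surjective : Function.Surjective (projBase : FrameModel E →L[ℝ] E) := fun X =>
  ⟨(X, 0), rfl⟩

theorem isMovingFrame_frameAt {g : E → E →L[ℝ] E →L[ℝ] ℝ} {K : E → E →L[ℝ] E} {V W : Set E}
    {e : Fin 4 → E → E} (hW : IsOpen W) (hWV : W ⊆ V) (he : IsAdaptedFrameOn g K W e) :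
    IsMovingFrame g K V projBase (frameBundle W) (frameAt e) where
  isOpen := by
    refine (hW.preimage continuous_fst).inter ?_
    refine isOpen_ne_fun ?_ continuous_const
    simp only [Matrix.det_fin_two, Matrix.of_apply]
    fun_prop
  mapsTo u hu := hWV hu.1
  adapted u hu := isAdaptedFrame_frameAt (he.adapted _ hu.1) hu.2
  smooth a := by
    have hs : ∀ c, ContDiffOn ℝ ∞ (fun u : FrameModel E => e c u.1) (frameBundle W) := fun c =>
      (he.smooth c).comp contDiffOn_fst fun u hu => hu.1
    have hc : ∀ i j, ContDiffOn ℝ ∞ (fun u : FrameModel E => u.2 i j) (frameBundle W) :=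
      fun i j => by fun_prop
    have hd : ContDiffOn ℝ ∞ (fun u : FrameModel E => ((Matrix.of u.2).det)⁻¹)
        (frameBundle W) := by
      refine ContDiffOn.inv ?_ fun u hu => hu.2
      simp only [Matrix.det_fin_two, Matrix.of_apply]
      fun_prop
    fin_cases a
    · exact ((hc 0 0).smul (hs 0)).add ((hc 1 0).smul (hs 1))
    · exact ((hc 0 1).smul (hs 0)).add ((hc 1 1).smul (hs 1))
    · refine ContDiffOn.congr (((hd.mul (hc 1 1)).smul (hs 2)).add
        ((hd.mul (hc 0 1).neg).smul (hs 3))) fun u _ => ?_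
      simp [frameAt, Matrix.inv_def, Matrix.adjugate_fin_two]
    · refine ContDiffOn.congr (((hd.mul (hc 1 0).neg).smul (hs 2)).add
        ((hd.mul (hc 0 0)).smul (hs 3))) fun u _ => ?_
      simp [frameAt, Matrix.inv_def, Matrix.adjugate_fin_two]

theorem extDeriv_oneForm_sub_smul_add {α β γ : E → E →L[ℝ] ℝ} {x : E}
    (hα : DifferentiableAt ℝ α x) (hβ : DifferentiableAt ℝ β x) (hγ : DifferentiableAt ℝ γ x)
    (c : ℝ) (m : Fin 2 → E) :
    extDeriv (fun y => oneForm (α y - c • (β y + γ y))) x m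
      = extDeriv (fun y => oneForm (α y)) x m - c * (extDeriv (fun y => oneForm (β y)) x m
        + extDeriv (fun y => oneForm (γ y)) x m) := by
  rw [extDeriv_oneForm_apply hα, extDeriv_oneForm_apply hβ, extDeriv_oneForm_apply hγ,
    extDeriv_oneForm_apply (hα.fun_sub ((hβ.fun_add hγ).fun_const_smul c)),
    fderiv_fun_sub hα ((hβ.fun_add hγ).fun_const_smul c), fderiv_fun_const_smul (hβ.fun_add hγ),
    fderiv_fun_add hβ hγ]
  simp
  ring

/-- The values of the curvature of the Cartan connection on the horizontal lifts of `X` and `Y`. -/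
noncomputable def horizontalCurvature (g : E → E →L[ℝ] E →L[ℝ] ℝ) (e : Fin 4 → E → E)
    (u : FrameModel E) (X Y : E) : Matrix (Fin 3) (Fin 3) ℝ :=
  let θ := coframe (g u.1) (frameAt e u)
  let Ω := fun a b => θ a (riemann g u.1 X Y (frameAt e u b))
  let w := fun a b => θ a X * θ b Y - θ a Y * θ b X
  let t := 1 / 3 * (Ω 0 0 + Ω 1 1)
  !![Ω 0 0 - t + w 0 2, Ω 0 1 + w 0 3, 0;
     Ω 1 0 + w 1 2, Ω 1 1 - t + w 1 3, 0;
     0, 0, -t + w 2 0 + w 3 1]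

section Curvature

variable [FiniteDimensional ℝ E] (hdim : Module.finrank ℝ E = 4)
  {g : E → E →L[ℝ] E →L[ℝ] ℝ} {K : E → E →L[ℝ] E} {V W : Set E} {e : Fin 4 → E → E}
  (h : IsParaKahlerEinsteinOn g K V) (hW : IsOpen W) (hWV : W ⊆ V)
  (he : IsAdaptedFrameOn g K W e) {u : FrameModel E} (hu : u ∈ frameBundle W)

include h hW hWV he hu

theorem contDiffAt_cartanConnection (i j : Fin 3) :
    ContDiffAt ℝ ∞ (fun y => cartanConnection g e y i j) u := by
  have : CompleteSpace E := FiniteDimensional.complete ℝ E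
  have F := isMovingFrame_frameAt hW hWV he
  have hΓ : ∀ a b, ContDiffAt ℝ ∞ (fun y => connectionForm g e y a b) u := fun a b =>
    F.contDiffAt_movingConnection h.toIsParaHermitianOn hu a b
  have hθ : ∀ a, ContDiffAt ℝ ∞ (fun y => tautForm g e y a) u := fun a =>
    F.contDiffAt_movingCoframe h.toIsParaHermitianOn hu a
  have ht : ContDiffAt ℝ ∞ (fun y => (1 / 3 : ℝ) • (connectionForm g e y 0 0
    + connectionForm g e y 1 1)) u := ((hΓ 0 0).add (hΓ 1 1)).const_smul (1 / 3 : ℝ)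
  fin_cases i <;> fin_cases j
  · exact (hΓ 0 0).sub ht
  · exact hΓ 0 1
  · exact hθ 0
  · exact hΓ 1 0
  · exact (hΓ 1 1).sub ht
  · exact hθ 1
  · exact hθ 2
  · exact hθ 3
  · exact ht.neg

include hdim

/-- Besides giving the entries, this shows that K_𝒜 is horizontal: its value depends only on the
base components of its arguments. -/
theorem cartanCurvature_apply (i j : Fin 3) (m : Fin 2 → FrameModel E) :
    cartanCurvature g e u i j m = horizontalCurvature g e u (m 0).1 (m 1).1 i j := by
  have : CompleteSpace E := FiniteDimensional.complete ℝ E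
  have F := isMovingFrame_frameAt hW hWV he
  have hP := h.toIsParaHermitianOn
  have hz : ∀ a b, paraSign a ≠ paraSign b → connectionForm g e u a b = 0 := fun a b hab =>
    F.movingConnection_mixed hP hu hdim h.parallel hab
  have hΓ : ∀ a b, DifferentiableAt ℝ (fun y => connectionForm g e y a b) u := fun a b =>
    (F.contDiffAt_movingConnection hP hu a b).differentiableAt (by simp)
  have s1 : ∀ c, extDeriv (fun y => oneForm (tautForm g e y c)) u m
      = -∑ a, wedge₁ (connectionForm g e u c a) (tautForm g e u a) m := fun c =>
    F.first_structure hP hu hdim c m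
  have s2 : ∀ c b, extDeriv (fun y => oneForm (connectionForm g e y c b)) u m
      + ∑ a, wedge₁ (connectionForm g e u c a) (connectionForm g e u a b) m
      = coframe (g u.1) (frameAt e u) c (riemann g u.1 (m 0).1 (m 1).1 (frameAt e u b)) :=
    fun c b => F.second_structure hP hu hdim c b m
  -- The connection on the barred vectors is minus the transpose of Γ, so the equations for dᾱ
  -- involve Γ alone.
  have k22 : connectionForm g e u 2 2 = -connectionForm g e u 0 0 :=
    F.movingConnection_skew hP hu 2 2
  have k23 : connectionForm g e u 2 3 = -connectionForm g e u 1 0 :=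
    F.movingConnection_skew hP hu 2 3
  have k32 : connectionForm g e u 3 2 = -connectionForm g e u 0 1 :=
    F.movingConnection_skew hP hu 3 2
  have k33 : connectionForm g e u 3 3 = -connectionForm g e u 1 1 :=
    F.movingConnection_skew hP hu 3 3
  have hd := fun a => extDeriv_oneForm_sub_smul_add (hΓ a a) (hΓ 0 0) (hΓ 1 1) (1 / 3) m
  -- The corner entry -⅓ tr Γ is the case of a zero first form.
  have hd0 := extDeriv_oneForm_sub_smul_add (differentiableAt_const 0) (hΓ 0 0) (hΓ 1 1) (1 / 3) m
  simp only [zero_sub, extDeriv_oneForm_apply (differentiableAt_const (0 : FrameModel E →L[ℝ] ℝ)),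
    fderiv_fun_const] at hd0
  have s10 := s1 0
  have s11 := s1 1
  have s12 := s1 2
  have s13 := s1 3
  have s200 := s2 0 0
  have s201 := s2 0 1
  have s210 := s2 1 0
  have s211 := s2 1 1
  simp only [Fin.sum_univ_four, hz 0 2 (by simp [paraSign_eq_iff]),
    hz 0 3 (by simp [paraSign_eq_iff]), hz 1 2 (by simp [paraSign_eq_iff]),
    hz 1 3 (by simp [paraSign_eq_iff]), hz 2 0 (by simp [paraSign_eq_iff]),
    hz 2 1 (by simp [paraSign_eq_iff]), hz 3 0 (by simp [paraSign_eq_iff]),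
    hz 3 1 (by simp [paraSign_eq_iff]), k22, k23, k32, k33, wedge₁_apply, zero_apply,
    neg_apply] at s10 s11 s12 s13 s200 s201 s210 s211
  have hθ : ∀ a (ξ : FrameModel E), tautForm g e u a ξ = coframe (g u.1) (frameAt e u) a ξ.1 :=
    fun _ _ => rfl
  have hK : ∀ i j, cartanCurvature g e u i j m
      = extDeriv (fun y => oneForm (cartanConnection g e y i j)) u m
      + ∑ k, wedge₁ (cartanConnection g e u i k) (cartanConnection g e u k j) m := fun i j => by
    simp [cartanCurvature, curvatureForm]
  have d00 : extDeriv (fun y => oneForm (cartanConnection g e y 0 0)) u m = _ := hd 0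
  have d11 : extDeriv (fun y => oneForm (cartanConnection g e y 1 1)) u m = _ := hd 1
  have d22 : extDeriv (fun y => oneForm (cartanConnection g e y 2 2)) u m = _ := hd0
  have d01 : extDeriv (fun y => oneForm (cartanConnection g e y 0 1)) u m
    = extDeriv (fun y => oneForm (connectionForm g e y 0 1)) u m := rfl
  have d10 : extDeriv (fun y => oneForm (cartanConnection g e y 1 0)) u m
    = extDeriv (fun y => oneForm (connectionForm g e y 1 0)) u m := rfl
  have d02 : extDeriv (fun y => oneForm (cartanConnection g e y 0 2)) u m
    = extDeriv (fun y => oneForm (tautForm g e y 0)) u m := rfl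
  have d12 : extDeriv (fun y => oneForm (cartanConnection g e y 1 2)) u m
    = extDeriv (fun y => oneForm (tautForm g e y 1)) u m := rfl
  have d20 : extDeriv (fun y => oneForm (cartanConnection g e y 2 0)) u m
    = extDeriv (fun y => oneForm (tautForm g e y 2)) u m := rfl
  have d21 : extDeriv (fun y => oneForm (cartanConnection g e y 2 1)) u m
    = extDeriv (fun y => oneForm (tautForm g e y 3)) u m := rfl
  rw [hK]
  fin_cases i <;> fin_cases j <;>
    simp only [Fin.zero_eta, Fin.mk_one, Fin.reduceFinMk, d00, d01, d02, d10, d11, d12, d20, d21,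
      d22, s10, s11, s12, s13, Fin.sum_univ_three, wedge₁_apply] <;>
    simp [cartanConnection, horizontalCurvature, ← hθ]
  · linear_combination s200 - 1 / 3 * (s200 + s211)
  · linear_combination s201
  · ring
  · linear_combination s210
  · linear_combination s211 - 1 / 3 * (s200 + s211)
  · ring
  · ring
  · ring
  · linear_combination -1 / 3 * (s200 + s211)

/-- The Kähler form `α¹ ∧ ᾱ¹ + α² ∧ ᾱ²` on the frame bundle. -/
noncomputable def kahlerForm (g : E → E →L[ℝ] E →L[ℝ] ℝ) (e : Fin 4 → E → E) (u : FrameModel E) :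
    FrameModel E [⋀^Fin 2]→L[ℝ] ℝ :=
  wedge₁ (tautForm g e u 0) (tautForm g e u 2) + wedge₁ (tautForm g e u 1) (tautForm g e u 3)

end Curvature

/-! ### The Hodge dual of the curvature -/

theorem IsAdaptedFrame.ext_two [FiniteDimensional ℝ E] (hdim : Module.finrank ℝ E = 4)
    {g : E →L[ℝ] E →L[ℝ] ℝ} {K : E →L[ℝ] E} {e : Fin 4 → E} (he : IsAdaptedFrame g K e)
    {η ζ : E [⋀^Fin 2]→L[ℝ] ℝ} (h : ∀ a b, a < b → η ![e a, e b] = ζ ![e a, e b]) : η = ζ := by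
  have hli : LinearIndependent ℝ e := by
    rw [Fintype.linearIndependent_iff]
    intro c hc a
    rw [← coframe_sum he c a, hc, map_zero]
  let B := basisOfLinearIndependentOfCardEqFinrank hli (by simp [hdim])
  have hB : ∀ a, B a = e a := fun a => by simp [B]
  have hswap : ∀ (ζ : E [⋀^Fin 2]→L[ℝ] ℝ) (X Y : E), ζ ![Y, X] = -ζ ![X, Y] := fun ζ X Y => by
    have := ζ.toAlternatingMap.map_swap ![X, Y] (i := 0) (j := 1) (by simp)
    have e : ![X, Y] ∘ Equiv.swap 0 1 = ![Y, X] := by ext i; fin_cases i <;> simp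
    rw [e] at this
    exact this
  apply ContinuousAlternatingMap.toAlternatingMap_injective
  refine B.ext_alternating fun v hv => ?_
  have hm : (fun i => B (v i)) = ![e (v 0), e (v 1)] := by ext i; fin_cases i <;> simp [hB]
  rw [hm]
  change η _ = ζ _
  rcases lt_trichotomy (v 0) (v 1) with hlt | heq | hgt
  · exact h _ _ hlt
  · exact absurd (hv heq) (by simp)
  · rw [hswap η, hswap ζ, h _ _ hgt]

/-- On type (1,1) the star exchanges the coefficients of α¹∧ᾱ¹ and α²∧ᾱ² and negates the other two.
Adding η therefore leaves the sum of these coefficients in front of both. -/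
theorem hodgeStar_eq_neg_add [FiniteDimensional ℝ E] (hdim : Module.finrank ℝ E = 4)
    {g : E →L[ℝ] E →L[ℝ] ℝ} {K : E →L[ℝ] E} {e : Fin 4 → E} (he : IsAdaptedFrame g K e)
    {η : E [⋀^Fin 2]→L[ℝ] ℝ} (h01 : η ![e 0, e 1] = 0) (h23 : η ![e 2, e 3] = 0) :
    hodgeStar g e η = -η + (η ![e 0, e 2] + η ![e 1, e 3]) •
      (wedge₁ (coframe g e 0) (coframe g e 2) + wedge₁ (coframe g e 1) (coframe g e 3)) := by
  refine he.ext_two hdim fun a b hab => ?_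
  fin_cases a <;> fin_cases b <;> first | exact absurd hab (by decide) | skip
  all_goals simp [hodgeStar, wedge₁_apply, coframe_apply_frame he, h01, h23]

section Lift

variable {g : E → E →L[ℝ] E →L[ℝ] ℝ} {K : E → E →L[ℝ] E} {e : Fin 4 → E → E} {u : FrameModel E}

theorem kahlerForm_lift (hA : IsAdaptedFrame (g u.1) (K u.1) (frameAt e u)) :
    kahlerForm g e u ![(frameAt e u 0, 0), (frameAt e u 2, 0)] = 1 := by
  have hθ : ∀ a X, tautForm g e u a (X, 0) = coframe (g u.1) (frameAt e u) a X := fun _ _ => rfl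
  simp [kahlerForm, wedge₁_apply, hθ, coframe_apply_frame hA]

/-- Shows α¹∧ω ≠ 0: it equals α¹∧α²∧ᾱ², and the three arguments are the dual frame vectors. -/
theorem wedge_kahlerForm_lift (hA : IsAdaptedFrame (g u.1) (K u.1) (frameAt e u)) :
    wedge (tautForm g e u 0) (kahlerForm g e u)
    ![(frameAt e u 0, 0), (frameAt e u 1, 0), (frameAt e u 3, 0)] = 1 := by
  have hθ : ∀ a X, tautForm g e u a (X, 0) = coframe (g u.1) (frameAt e u) a X := fun _ _ => rfl
  simp [wedge_two, kahlerForm, wedge₁_apply, hθ, coframe_apply_frame hA]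

end Lift

theorem extDeriv_fun_neg {n : ℕ} (η : E → E [⋀^Fin n]→L[ℝ] ℝ) (x : E) :
    extDeriv (fun y => -η y) x = -extDeriv η x := by
  have := extDeriv_fun_smul (x := x) (-1 : ℝ) η
  rw [neg_one_smul, neg_one_smul] at this
  exact this

/-! ### Anti-self-duality and the Yang–Mills equations -/

section Curvature

variable [FiniteDimensional ℝ E] (hdim : Module.finrank ℝ E = 4)
  {g : E → E →L[ℝ] E →L[ℝ] ℝ} {K : E → E →L[ℝ] E} {V W : Set E} {e : Fin 4 → E → E}
  (h : IsParaKahlerEinsteinOn g K V) (hW : IsOpen W) (hWV : W ⊆ V)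
  (he : IsAdaptedFrameOn g K W e) {u : FrameModel E} (hu : u ∈ frameBundle W)

include hdim h hW hWV he hu

theorem psiTwoPrime_frameAt :
    psiTwoPrime g u.1 (frameAt e u) = -(scalarCurvature g u.1 / 4 / 3) :=
  (isMovingFrame_frameAt hW hWV he).psiTwoPrime_eq h.toIsParaHermitianOn hu hdim h.parallel
    projBase_surjective (h.einstein u.1 (hWV hu.1))

/-- Exactly the data that the Hodge formula needs: type (1,1) and the ω-trace. In the ω-trace Ω - ⅓
tr Ω contributes Λ/3 and α∧ᾱ contributes 1 on the block diagonal, the corner is -2 times their sum,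
and Λ/3 = -Ψ₂'. -/
theorem horizontalCurvature_components (i j : Fin 3) :
    horizontalCurvature g e u (frameAt e u 0) (frameAt e u 1) i j = 0 ∧
    horizontalCurvature g e u (frameAt e u 2) (frameAt e u 3) i j = 0 ∧
    horizontalCurvature g e u (frameAt e u 0) (frameAt e u 2) i j
      + horizontalCurvature g e u (frameAt e u 1) (frameAt e u 3) i j
      = (1 - psiTwoPrime g u.1 (frameAt e u)) * Matrix.diagonal ![1, 1, -2] i j := by
  have F := isMovingFrame_frameAt hW hWV he
  have hA : IsAdaptedFrame (g u.1) (K u.1) (frameAt e u) := F.adapted u hu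
  have hr := F.isParaKahlerEinsteinCurvature h.toIsParaHermitianOn hu hdim h.parallel
    projBase_surjective (h.einstein u.1 (hWV hu.1))
  have r01 := fun a b => hr.eq_zero_of_same_type a b (c := 0) (d := 1) rfl
  have r23 := fun a b => hr.eq_zero_of_same_type a b (c := 2) (d := 3) rfl
  have r1 := hr.ricci_form_zero
  have r2 := hr.ricci_form_one
  have r3 := hr.ricci_form_zero_one
  have r4 := hr.ricci_form_one_zero
  have hπ : (projBase : FrameModel E →L[ℝ] E) u = u.1 := rfl
  simp only [hπ] at r01 r23 r1 r2 r3 r4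
  rw [psiTwoPrime_frameAt hdim h hW hWV he hu]
  fin_cases i <;> fin_cases j <;>
    simp [horizontalCurvature, coframe_apply_frame hA, r01, r23] <;> linarith

theorem starCurvature_apply (i j : Fin 3) :
    starCurvature g e u i j = -cartanCurvature g e u i j
      + ((1 - psiTwoPrime g u.1 (frameAt e u)) * Matrix.diagonal ![1, 1, -2] i j) •
        kahlerForm g e u := by
  have hA := isAdaptedFrame_frameAt (he.adapted _ hu.1) hu.2
  obtain ⟨c01, c23, ct⟩ := horizontalCurvature_components hdim h hW hWV he hu i j
  -- The 2-covector on the base whose pullback is the given entry of K_𝒜; horizontality is what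
  -- makes `hKκ` true.
  let κ := (cartanCurvature g e u i j).compContinuousLinearMap (ContinuousLinearMap.inl ℝ E _)
  have hκ : ∀ X Y, κ ![X, Y] = horizontalCurvature g e u X Y i j := fun X Y =>
    cartanCurvature_apply hdim h hW hWV he hu i j _
  have hs := hodgeStar_eq_neg_add hdim hA (η := κ) ((hκ _ _).trans c01) ((hκ _ _).trans c23)
  rw [hκ, hκ, ct] at hs
  have hKκ : ∀ m, cartanCurvature g e u i j m = κ fun k => (m k).1 := fun m => by
    have hm : (fun k => (m k).1) = ![(m 0).1, (m 1).1] := by ext k; fin_cases k <;> rfl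
    rw [hm, hκ, cartanCurvature_apply hdim h hW hWV he hu]
  ext m
  change hodgeStar (g u.1) (frameAt e u) κ (fun k => (m k).1) = _
  rw [hs]
  simp [kahlerForm, wedge₁_apply, hKκ]
  rfl

theorem starCurvature_eq_neg_iff :
    starCurvature g e u = -cartanCurvature g e u ↔ psiTwoPrime g u.1 (frameAt e u) = 1 := by
  have key := starCurvature_apply hdim h hW hWV he hu
  constructor
  · intro hs
    -- In the corner entry the coefficient of ω is -2(1 - Ψ₂'), and ω takes the value 1 on the
    -- chosen pair.
    have h2 := key 2 2
    rw [hs] at h2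
    have h3 := congrArg (fun η => η ![(frameAt e u 0, 0), (frameAt e u 2, 0)]) h2
    simp [kahlerForm_lift (isAdaptedFrame_frameAt (he.adapted _ hu.1) hu.2)] at h3
    linarith
  · intro hψ
    ext1 i j
    rw [key, hψ]
    simp

omit hdim in
theorem covExtDeriv_cartanCurvature :
    covExtDeriv (cartanConnection g e) (cartanCurvature g e) u = 0 :=
  covExtDeriv_curvatureForm (contDiffAt_cartanConnection h hW hWV he hu)

theorem psiTwoPrime_eq_one_of_yangMills
    (hY : covExtDeriv (cartanConnection g e) (starCurvature g e) u = 0) :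
    psiTwoPrime g u.1 (frameAt e u) = 1 := by
  have key := starCurvature_apply hdim h hW hWV he hu
  have hO := (isMovingFrame_frameAt hW hWV he).isOpen.mem_nhds hu
  -- The correction to -K_𝒜 is diagonal, so this off-diagonal entry satisfies *K = -K near u and its
  -- exterior derivative cancels against that in the Bianchi identity.
  have hloc : (fun y => starCurvature g e y 0 2) =ᶠ[𝓝 u] fun y => -cartanCurvature g e y 0 2 := by
    filter_upwards [hO] with y hy
    rw [starCurvature_apply hdim h hW hWV he hy]
    simp
  have hd : extDeriv (fun y => starCurvature g e y 0 2) u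
      = -extDeriv (fun y => cartanCurvature g e y 0 2) u := by
    rw [hloc.extDeriv_eq, extDeriv_fun_neg]
  have h1 := congrFun (congrFun hY 0) 2
  have h2 := congrFun (congrFun (covExtDeriv_cartanCurvature h hW hWV he hu) 0) 2
  simp only [covExtDeriv, Matrix.of_apply, hd, key, Fin.sum_univ_three, wedge_add, wedge_smul,
    wedge_neg, Matrix.zero_apply] at h1 h2
  -- In the sum of the two equations only 𝒜₀₂ = α¹ meets the diagonal correction, with factors -2
  -- and -1, leaving -3(1 - Ψ₂') α¹∧ω.
  have h3 := congrArg (fun η => η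
    ![(frameAt e u 0, 0), (frameAt e u 1, 0), (frameAt e u 3, 0)]) (congrArg₂ (· + ·) h1 h2)
  have hw := wedge_kahlerForm_lift (isAdaptedFrame_frameAt (he.adapted _ hu.1) hu.2)
  have hc : cartanConnection g e u 0 2 = tautForm g e u 0 := rfl
  simp [hc, hw] at h3
  linarith

theorem covExtDeriv_starCurvature (hψ : ∀ y ∈ frameBundle W, psiTwoPrime g y.1 (frameAt e y) = 1) :
    covExtDeriv (cartanConnection g e) (starCurvature g e) u = 0 := by
  have hO := (isMovingFrame_frameAt hW hWV he).isOpen.mem_nhds hu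
  have hs : ∀ y ∈ frameBundle W, starCurvature g e y = -cartanCurvature g e y := fun y hy =>
    (starCurvature_eq_neg_iff hdim h hW hWV he hy).2 (hψ y hy)
  have hd : ∀ i j, extDeriv (fun y => starCurvature g e y i j) u
      = -extDeriv (fun y => cartanCurvature g e y i j) u := fun i j => by
    have hloc : (fun y => starCurvature g e y i j) =ᶠ[𝓝 u] fun y => -cartanCurvature g e y i j := by
      filter_upwards [hO] with y hy
      rw [hs y hy]
      rfl
    rw [hloc.extDeriv_eq, extDeriv_fun_neg]
  have hB := covExtDeriv_cartanCurvature h hW hWV he hu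
  rw [← neg_zero, ← hB]
  ext1 i j
  simp only [covExtDeriv, Matrix.of_apply, hd, hs u hu, Matrix.neg_apply, wedge_neg,
    Finset.sum_neg_distrib]
  abel

end Curvature

/-! ### Local adapted frames -/

/-- An adapted frame at a point extends to a smooth adapted frame near that point. -/
theorem IsParaHermitianOn.exists_adaptedFrameOn {g : E → E →L[ℝ] E →L[ℝ] ℝ} {K : E → E →L[ℝ] E}
    {V : Set E} (h : IsParaHermitianOn g K V) {x : E} (hx : x ∈ V) {f : Fin 4 → E}
    (hf : IsAdaptedFrame (g x) (K x) f) :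
    ∃ W ⊆ V, IsOpen W ∧ x ∈ W ∧ ∃ e : Fin 4 → E → E, IsAdaptedFrameOn g K W e ∧
      ∀ a, e a x = f a := by
  have hs : ∀ a, paraSign a * paraSign a = 1 := fun a => by
    fin_cases a <;> simp [paraSign]
  -- Eigenprojections of the constant vectors `f a`: the eigenvalue condition holds on V, and only
  -- the pairing between the two eigenspaces needs correction.
  let p : Fin 4 → E → E := fun a y => (1 / 2 : ℝ) • (f a + paraSign a • K y (f a))
  have hp : ∀ a, ContDiffOn ℝ ∞ (p a) V := fun a =>
    contDiffOn_const.smul (contDiffOn_const.add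
      (contDiffOn_const.smul (h.smooth_endo.clm_apply contDiffOn_const)))
  have hpK : ∀ a, ∀ y ∈ V, K y (p a y) = paraSign a • p a y := fun a y hy => by
    simp only [p, map_smul, map_add, h.endo_sq y hy]
    rw [smul_comm (paraSign a), smul_add (paraSign a), smul_smul (paraSign a), hs, one_smul,
      add_comm]
  have hpx : ∀ a, p a x = f a := fun a => by
    simp only [p, hf.eigen, smul_smul, hs]
    module
  let G : Fin 4 → Fin 4 → E → ℝ := fun a b y => g y (p a y) (p b y)
  have hG : ∀ a b, ContDiffOn ℝ ∞ (G a b) V := fun a b =>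
    (h.smooth.clm_apply (hp a)).clm_apply (hp b)
  have hG0 : ∀ a b, paraSign a = paraSign b → ∀ y ∈ V, g y (p a y) (p b y) = 0 := by
    intro a b hab y hy
    exact h.isotropic hy (hs a) (hpK a y hy) (hab ▸ hpK b y hy)
  -- Determinant of the pairing between the projected positive and negative vectors; it equals 1 at
  -- x, so W is a neighbourhood of x.
  let D : E → ℝ := fun y => G 0 2 y * G 1 3 y - G 0 3 y * G 1 2 y
  have hD : ContDiffOn ℝ ∞ D V := ((hG 0 2).mul (hG 1 3)).sub ((hG 0 3).mul (hG 1 2))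
  let W : Set E := V ∩ D ⁻¹' {0}ᶜ
  have hWV : W ⊆ V := Set.inter_subset_left
  have hGx : ∀ a b, G a b x = nullGram a b := fun a b => by simp only [G, hpx, hf.gram]
  have hDx : D x = 1 := by simp [D, hGx, nullGram]
  -- Of the function 1/D only D I = 1 is retained, so that the Gram relations become linear
  -- combinations of this equation.
  obtain ⟨I, hI, hDI, hIx⟩ : ∃ I : E → ℝ, ContDiffOn ℝ ∞ I W ∧ (∀ y ∈ W, D y * I y = 1) ∧
      I x = 1 :=
    ⟨fun y => (D y)⁻¹, (hD.mono hWV).inv fun y hy => hy.2, fun y hy => mul_inv_cancel₀ hy.2,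
      by simp [hDx]⟩
  refine ⟨W, hWV, hD.continuousOn.isOpen_inter_preimage h.isOpen isOpen_compl_singleton,
    ⟨hx, by simp [hDx]⟩,
    -- The positive vectors are kept, and the negative ones are replaced by the basis dual to them
    -- under g, by Cramer's rule.
    ![p 0, p 1, fun y => (I y * G 1 3 y) • p 2 y + (I y * -G 1 2 y) • p 3 y,
      fun y => (I y * -G 0 3 y) • p 2 y + (I y * G 0 2 y) • p 3 y], ⟨?_, ?_⟩, ?_⟩
  · intro a
    fin_cases a
    · exact (hp 0).mono hWV
    · exact (hp 1).mono hWV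
    · exact ((hI.mul ((hG 1 3).mono hWV)).smul ((hp 2).mono hWV)).add
        ((hI.mul ((hG 1 2).mono hWV).neg).smul ((hp 3).mono hWV))
    · exact ((hI.mul ((hG 0 3).mono hWV).neg).smul ((hp 2).mono hWV)).add
        ((hI.mul ((hG 0 2).mono hWV)).smul ((hp 3).mono hWV))
  · intro y hy
    have hyV := hWV hy
    have z := fun a b (hab : paraSign a = paraSign b) => hG0 a b hab y hyV
    have z00 := z 0 0 rfl
    have z01 := z 0 1 rfl
    have z10 := z 1 0 rfl
    have z11 := z 1 1 rfl
    have z22 := z 2 2 rfl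
    have z23 := z 2 3 rfl
    have z32 := z 3 2 rfl
    have z33 := z 3 3 rfl
    have s := fun a b => h.symm y hyV (p a y) (p b y)
    have s20 := s 2 0
    have s30 := s 3 0
    have s21 := s 2 1
    have s31 := s 3 1
    have hDG : (g y (p 0 y) (p 2 y) * g y (p 1 y) (p 3 y)
      - g y (p 0 y) (p 3 y) * g y (p 1 y) (p 2 y)) * I y = 1 := hDI y hy
    constructor
    · intro a b
      fin_cases a <;> fin_cases b <;>
        simp [nullGram, G, z00, z01, z10, z11, z22, z23, z32, z33, s20, s30, s21, s31] <;>
        first | ring1 | linear_combination hDG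
    · intro a
      fin_cases a
      · exact hpK 0 y hyV
      · exact hpK 1 y hyV
      · have h2 := hpK 2 y hyV
        have h3 := hpK 3 y hyV
        simp [paraSign] at h2 h3
        simp [paraSign, h2, h3]
      · have h2 := hpK 2 y hyV
        have h3 := hpK 3 y hyV
        simp [paraSign] at h2 h3
        simp [paraSign, h2, h3]
  · intro a
    fin_cases a <;> simp [hpx, hGx, hIx, nullGram]

theorem frameAt_one (e : Fin 4 → E → E) (x : E) :
    frameAt e (x, (1 : Matrix (Fin 2) (Fin 2) ℝ)) = fun a => e a x := by
  have h1 : Matrix.of (1 : Matrix (Fin 2) (Fin 2) ℝ) = 1 := rfl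
  funext a
  fin_cases a <;> simp [frameAt, h1]

/-! ### Chart representatives of a para-Kähler-Einstein structure -/

/-- A basis with diagonal Gram matrix ±1 gives injectivity of E → E*, and equality of dimensions
does the rest. This and the next two lemmas are stated for maps of E, with which the tangent spaces
agree definitionally. -/
theorem isInvertible_bilinearComp [FiniteDimensional ℝ E] {G : E →L[ℝ] E →L[ℝ] ℝ}
    {D D' : E →L[ℝ] E} (hDD' : ∀ v, D (D' v) = v) (hD'D : ∀ v, D' (D v) = v)
    (b : Module.Basis (Fin 4) ℝ E)
    (hb : ∀ i j, G (b i) (b j) = if i = j then ![1, 1, -1, -1] i else 0) :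
    (G.bilinearComp D D).IsInvertible := by
  have hinj : Function.Injective (G.bilinearComp D D) := by
    rw [injective_iff_map_eq_zero]
    intro v hv
    have hz : ∀ j, G (D v) (b j) = 0 := fun j => by
      simpa [hDD'] using congrArg (fun T : E →L[ℝ] ℝ => T (D' (b j))) hv
    have hv0 : D v = 0 := by
      apply b.ext_elem
      intro j
      have h1 := hz j
      rw [← b.sum_repr (D v)] at h1
      simp only [map_sum, map_smul, sum_apply, smul_apply, hb, smul_eq_mul, mul_ite,
        mul_zero, Finset.sum_ite_eq', Finset.mem_univ, if_true] at h1
      rw [map_zero]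
      refine (mul_eq_zero.1 h1).resolve_right ?_
      fin_cases j <;> simp
    rw [← hD'D v, hv0, map_zero]
  let L : E ≃ₗ[ℝ] (E →L[ℝ] ℝ) :=
    LinearEquiv.ofInjectiveOfFinrankEq (G.bilinearComp D D : E →ₗ[ℝ] (E →L[ℝ] ℝ)) hinj (by
      rw [← LinearMap.toContinuousLinearMap.finrank_eq]
      exact (Subspace.dual_finrank_eq).symm)
  exact ⟨L.toContinuousLinearEquiv, by ext; rfl⟩

theorem conj_endo_sq {J D D' : E →L[ℝ] E} (hDD' : ∀ v, D (D' v) = v) (hD'D : ∀ v, D' (D v) = v)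
    (hJ : ∀ v, J (J v) = v) (v : E) :
    ((D'.comp J).comp D) (((D'.comp J).comp D) v) = v := by
  simp [hDD', hD'D, hJ]

theorem bilinearComp_conj_endo {G : E →L[ℝ] E →L[ℝ] ℝ} {J D D' : E →L[ℝ] E}
    (hDD' : ∀ v, D (D' v) = v) (hJ : ∀ v w, G (J v) (J w) = -G v w) (v w : E) :
    G.bilinearComp D D (((D'.comp J).comp D) v) (((D'.comp J).comp D) w)
      = -G.bilinearComp D D v w := by
  simp [hDD', hJ]

namespace AlmostParaHermitian

variable {M : Type*} [TopologicalSpace M] [ChartedSpace E M] [IsManifold 𝓘(ℝ, E) ∞ M]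
  (S : AlmostParaHermitian E M) {φ : OpenPartialHomeomorph M E} (hφ : φ ∈ atlas E M)

include hφ

omit S in
theorem mfderiv_chart_inverse {x : E} (hx : x ∈ φ.target) :
    (∀ v, mfderiv 𝓘(ℝ, E) 𝓘(ℝ, E) φ.symm x (mfderiv 𝓘(ℝ, E) 𝓘(ℝ, E) φ (φ.symm x) v) = v) ∧
    ∀ v, mfderiv 𝓘(ℝ, E) 𝓘(ℝ, E) φ (φ.symm x) (mfderiv 𝓘(ℝ, E) 𝓘(ℝ, E) φ.symm x v) = v := by
  have : IsManifold 𝓘(ℝ, E) 1 M := IsManifold.of_le (n := ∞) (one_le_two.trans ENat.LEInfty.out)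
  have hmd := mdifferentiable_of_mem_atlas (I := 𝓘(ℝ, E)) hφ
  refine ⟨fun v => ?_, fun v => congrArg (fun T => T v) (hmd.comp_symm_deriv hx)⟩
  have := hmd.symm_comp_deriv (φ.map_target hx)
  rw [φ.right_inv hx] at this
  exact congrArg (fun T => T v) this

theorem localBilin_isInvertible [FiniteDimensional ℝ E] {x : E} (hx : x ∈ φ.target) :
    (localBilin S.g φ x).IsInvertible := by
  obtain ⟨h1, h2⟩ := mfderiv_chart_inverse hφ hx
  obtain ⟨b, hb⟩ := S.signature (φ.symm x)
  exact isInvertible_bilinearComp (E := E) (G := S.g (φ.symm x)) h1 h2 b hb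

omit [IsManifold 𝓘(ℝ, E) ∞ M] hφ in
theorem localBilin_symm {x : E} (v w : E) :
    localBilin S.g φ x v w = localBilin S.g φ x w v :=
  S.symm (φ.symm x) (mfderiv 𝓘(ℝ, E) 𝓘(ℝ, E) φ.symm x v) (mfderiv 𝓘(ℝ, E) 𝓘(ℝ, E) φ.symm x w)

theorem localEndo_sq {x : E} (hx : x ∈ φ.target) (v : E) :
    localEndo S.K φ x (localEndo S.K φ x v) = v := by
  obtain ⟨h1, h2⟩ := mfderiv_chart_inverse hφ hx
  exact conj_endo_sq (E := E) (J := S.K (φ.symm x)) h1 h2 (S.K_sq _) v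

theorem localBilin_localEndo {x : E} (hx : x ∈ φ.target) (v w : E) :
    localBilin S.g φ x (localEndo S.K φ x v) (localEndo S.K φ x w)
      = -localBilin S.g φ x v w := by
  obtain ⟨h1, -⟩ := mfderiv_chart_inverse hφ hx
  exact bilinearComp_conj_endo (E := E) (G := S.g (φ.symm x)) (J := S.K (φ.symm x)) h1
    (S.compat _) v w

theorem isParaHermitianOn_chart [FiniteDimensional ℝ E] :
    IsParaHermitianOn (localBilin S.g φ) (localEndo S.K φ) φ.target where
  isOpen := φ.open_target
  smooth := S.smooth_g φ hφ
  smooth_endo := S.smooth_K φ hφ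
  symm _ _ v w := S.localBilin_symm v w
  nondegenerate _ hx := S.localBilin_isInvertible hφ hx
  endo_sq _ hx := S.localEndo_sq hφ hx
  compat _ hx := S.localBilin_localEndo hφ hx

theorem isParaKahlerEinsteinOn_chart [FiniteDimensional ℝ E] (hK : S.IsParaKahler)
    (hE : S.IsEinstein) :
    IsParaKahlerEinsteinOn (localBilin S.g φ) (localEndo S.K φ) φ.target where
  toIsParaHermitianOn := S.isParaHermitianOn_chart hφ
  parallel x hx := (S.isParaHermitianOn_chart hφ).covDerivEndo_eq_zero hx
    (hK.integrable_pos φ hφ) (hK.integrable_neg φ hφ) (hK.closed φ hφ x hx)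
  einstein x hx v w := sub_eq_zero.1 (hE φ hφ x hx v w)

end AlmostParaHermitian

/-- A property of the points of the frame bundle that implies `Ψ₂' = c` at each point, and follows
from `Ψ₂' = c` on each bundle chart, holds everywhere if and only if `Ψ₂' = c` everywhere. -/
theorem AlmostParaHermitian.onFrameBundle_iff_hasPsiTwoPrime [FiniteDimensional ℝ E]
    {M : Type*} [TopologicalSpace M] [ChartedSpace E M] [IsManifold 𝓘(ℝ, E) ∞ M]
    (S : AlmostParaHermitian E M)
    {P : (E → E →L[ℝ] E →L[ℝ] ℝ) → (Fin 4 → E → E) → FrameModel E → Prop} {c : ℝ}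
    (h₁ : ∀ φ ∈ atlas E M, ∀ W ⊆ φ.target, IsOpen W → ∀ e : Fin 4 → E → E,
      IsAdaptedFrameOn (localBilin S.g φ) (localEndo S.K φ) W e → ∀ u ∈ frameBundle W,
        P (localBilin S.g φ) e u → psiTwoPrime (localBilin S.g φ) u.1 (frameAt e u) = c)
    (h₂ : ∀ φ ∈ atlas E M, ∀ W ⊆ φ.target, IsOpen W → ∀ e : Fin 4 → E → E,
      IsAdaptedFrameOn (localBilin S.g φ) (localEndo S.K φ) W e →
      (∀ y ∈ frameBundle W, psiTwoPrime (localBilin S.g φ) y.1 (frameAt e y) = c) →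
        ∀ u ∈ frameBundle W, P (localBilin S.g φ) e u) :
    S.OnFrameBundle P ↔ ∀ p : M, S.HasPsiTwoPrime p c := by
  constructor
  · intro hP p φ hφ hp f hf
    obtain ⟨W, hWV, hW, hpW, e, he, hef⟩ :=
      (S.isParaHermitianOn_chart hφ).exists_adaptedFrameOn (φ.map_source hp) hf
    -- The identity matrix represents the given frame itself, so the property of bundle points can
    -- be tested at any prescribed adapted frame.
    have hu : ((φ p, (1 : Matrix (Fin 2) (Fin 2) ℝ)) : FrameModel E) ∈ frameBundle W :=
      ⟨hpW, by
        change (1 : Matrix (Fin 2) (Fin 2) ℝ).det ≠ 0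
        simp⟩
    have := h₁ φ hφ W hWV hW e he _ hu (hP φ hφ W hWV hW e he _ hu)
    rw [frameAt_one] at this
    simpa only [hef] using this
  · intro hψ φ hφ W hWV hW e he
    refine h₂ φ hφ W hWV hW e he fun y hy => ?_
    have hy' := φ.right_inv (hWV hy.1)
    have := hψ (φ.symm y.1) φ hφ (φ.map_target (hWV hy.1)) (frameAt e y)
    rw [hy'] at this
    exact this (isAdaptedFrame_frameAt (he.adapted _ hy.1) hy.2)

end ParaKahler

open ParaKahler in
theorem mainTheorem5 {E : Type*} [NormedAddCommGroup E] [NormedSpace ℝ E] [FiniteDimensional ℝ E]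
    (hdim : Module.finrank ℝ E = 4)
    {M : Type*} [TopologicalSpace M] [ChartedSpace E M] [IsManifold 𝓘(ℝ, E) ∞ M]
    (S : AlmostParaHermitian E M) (hK : S.IsParaKahler) (hE : S.IsEinstein) :
    (S.SatisfiesYangMills ↔ ∀ p : M, S.HasPsiTwoPrime p 1) ∧
    (S.HasAntiSelfDualCurvature ↔ ∀ p : M, S.HasPsiTwoPrime p 1) ∧
    S.SatisfiesBianchi := by
  refine ⟨S.onFrameBundle_iff_hasPsiTwoPrime ?_ ?_, S.onFrameBundle_iff_hasPsiTwoPrime ?_ ?_, ?_⟩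
  · intro φ hφ W hWV hW e he u hu
    exact psiTwoPrime_eq_one_of_yangMills hdim (S.isParaKahlerEinsteinOn_chart hφ hK hE) hW hWV he hu
  · intro φ hφ W hWV hW e he hψ u hu
    exact covExtDeriv_starCurvature hdim (S.isParaKahlerEinsteinOn_chart hφ hK hE) hW hWV he hu hψ
  · intro φ hφ W hWV hW e he u hu
    exact (starCurvature_eq_neg_iff hdim (S.isParaKahlerEinsteinOn_chart hφ hK hE) hW hWV he hu).1
  · intro φ hφ W hWV hW e he hψ u hu
    exact (starCurvature_eq_neg_iff hdim (S.isParaKahlerEinsteinOn_chart hφ hK hE) hW hWV he hu).2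
      (hψ u hu)
  · intro φ hφ W hWV hW e he u hu
    exact covExtDeriv_cartanCurvature (S.isParaKahlerEinsteinOn_chart hφ hK hE) hW hWV he hu
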